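/- Let $R$ be a commutative ring and let $\mathsf{FI}$ be the category of finite sets and injections; write $[n]$ for the standard set with $n$ elements. An $R$-valued $\mathsf{FI}$-module is a functor $M\colon \mathsf{FI}\to R\text{-}\mathsf{Mod}$, and $M_n := M_{[n]}$. It is \emph{presented in degrees $\le d$} if there is an exact sequence $\bigoplus_{j\in J} R\,\mathsf{FI}([b_j],-)\to\bigoplus_{i\in I} R\,\mathsf{FI}([a_i],-)\to M\to 0$ with all $a_i,b_j\le d$ (the index sets $I,J$ may be infinite). For $\ell\in\mathbb N$, let $\Xi(\ell)$ be the $\mathsf{FI}^{\mathrm{op}}$-module $\Xi(\ell)_S=H_0(X_S,A_S)$ (singular homology with integer coefficients), where $X_S=\mathrm{Emb}(S,[\ell]\sqcup\mathbb R)$ is the space of embeddings of the finite discrete space $S$ into $[\ell]\sqcup\mathbb R$, and $A_S\subseteq X_S$ is the subspace of those $\phi$ with $[\ell]\not\subseteq\operatorname{im}\phi$; injections act by precomposition. Let $A_\ell := M\otimes_{\mathsf{FI}}\Xi(\ell)$ be the functor tensor product, i.e. the $R$-module obtained from $\bigoplus_n M_n\otimes_{\mathbb Z}\Xi(\ell)_n$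 by dividing out the relations $M_f(m)\otimes\xi = m\otimes \Xi(\ell)_f(\xi)$ for all injections $f\colon[p]\to[q]$, $m\in M_p$, $\xi\in\Xi(\ell)_q$. \textbf{Theorem A.} Let $d\in\mathbb N$ and let $M$ be an $R$-valued $\mathsf{FI}$-module presented in degrees $\le d$. Then for all $n\ge 2d-1$ the integers $\binom n\ell-\binom n{\ell-1}$, $0\le\ell\le d$, are nonnegative (where $\binom n{-1}=0$), and there is an isomorphism of $R$-modules $$M_n\;\cong\;\bigoplus_{\ell=0}^{d} A_\ell^{\oplus\left(\binom n\ell-\binom n{\ell-1}\right)}.$$ In particular, if $R$ is a field and $M_n$ is finite-dimensional for all sufficiently large $n$, then $A_0,\dots,A_d$ are finite-dimensional, and there is exactly one polynomial $P\in\mathbb Q[x]$ with $\dim_R M_n=P(n)$ for all sufficiently large $n$ (the Hilbert polynomial of $M$), namely the nonnegative integer combination $$P(x)=\sum_{\ell=0}^{d}\dim_R(A_\ell)\left(\binom x\ell-\binom x{\ell-1}\right)$$ of the polynomials $\binom x\ell-\binom x{\ell-1}$, where $\binom x\ell = x(x-1)\cdots(x-\ell+1)/\ell!$ and $\binom x{-1}=0$.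 -/

import Mathlib

open CategoryTheory Filter
open scoped DirectSum TensorProduct Polynomial

universe u v

noncomputable section

/-- An object of the category `FI`: a finite set. -/
structure FI where
  /-- the underlying set -/
  carrier : Type
  [finite : Finite carrier]

namespace FI

/-- The category of finite sets and injections. -/
instance : Category FI where
  Hom S T := S.carrier ↪ T.carrier
  id S := Function.Embedding.refl S.carrier
  comp f g := Function.Embedding.trans f g

/-- The standard set with `n` elements, as an object of `FI`. -/
def std (n : ℕ) : FI := ⟨Fin n⟩

/-- The map of sets underlying a morphism of `FI`. -/
def toFun {S T : FI} (f : S ⟶ T) : S.carrier → T.carrier :=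
  (show S.carrier ↪ T.carrier from f)

theorem toFun_injective {S T : FI} (f : S ⟶ T) : Function.Injective (toFun f) :=
  (show S.carrier ↪ T.carrier from f).injective

end FI

/-! Generators and relations -/

section Presentation

variable {R : Type u} [CommRing R]

/-- The value at `S` of the free `R`-valued `FI`-module `⨁ i, R FI([a i], -)` on a family of
generators, the `i`-th one in degree `a i`: the free `R`-module on all pairs of an index `i` and an
injection `[a i] → S`. -/
abbrev FreeFI (R : Type u) [CommRing R] {I : Type v} (a : I → ℕ) (S : FI) : Type (max u v) :=
  (Σ i : I, (FI.std (a i) ⟶ S)) →₀ R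

/-- The action of an injection on the free `FI`-module, by postcomposition. -/
def FreeFI.map (R : Type u) [CommRing R] {I : Type v} (a : I → ℕ) {S T : FI} (f : S ⟶ T) :
    FreeFI R a S →ₗ[R] FreeFI R a T :=
  Finsupp.lmapDomain R R (fun p => ⟨p.1, p.2 ≫ f⟩)

/-- The map of `FI`-modules from the free `FI`-module to `M` that sends the `i`-th generator to the
element `g i` of `M` in degree `a i`. -/
def FreeFI.desc (M : FI ⥤ ModuleCat.{v} R) {I : Type v} (a : I → ℕ)
    (g : ∀ i, M.obj (FI.std (a i))) (S : FI) : FreeFI R a S →ₗ[R] M.obj S :=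
  Finsupp.linearCombination R (fun p => (M.map p.2).hom (g p.1))

/-- `M` is presented in degrees `≤ d`: there are (possibly infinite) families of generators `g i`
of degree `a i ≤ d` and of relations `r j` of degree `b j ≤ d` between them such that the `g i`
generate `M`, and all relations between the `g i` are consequences of the `r j`; that is, the
sequence `⨁ j, R FI([b j], -) → ⨁ i, R FI([a i], -) → M → 0` is exact. -/
def IsPresentedInDegreesLE (M : FI ⥤ ModuleCat.{v} R) (d : ℕ) : Prop :=
  ∃ (I : Type v) (a : I → ℕ) (g : ∀ i, M.obj (FI.std (a i)))
    (J : Type (max u v)) (b : J → ℕ) (r : ∀ j, FreeFI R a (FI.std (b j))),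
    (∀ i, a i ≤ d) ∧ (∀ j, b j ≤ d) ∧
    (∀ S : FI, Function.Surjective (FreeFI.desc M a g S)) ∧
    (∀ S : FI, LinearMap.ker (FreeFI.desc M a g S) =
      Submodule.span R {y | ∃ (j : J) (f : FI.std (b j) ⟶ S), y = FreeFI.map R a f (r j)})

end Presentation

/-! Zeroth relative homology -/

/-- Inside the group `C₀(X) = ℤ X` of singular `0`-chains: the subgroup `∂ C₁(X) + C₀(A)`, spanned
by the boundaries of the singular `1`-simplices (paths) of `X` and by the points of `A`. -/
def relBoundaries (X : Type) [TopologicalSpace X] (A : Set X) : Submodule ℤ (X →₀ ℤ) :=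
  Submodule.span ℤ
    ({z | ∃ (x y : X) (_ : Path x y), z = Finsupp.single y 1 - Finsupp.single x 1} ∪
      {z | ∃ x ∈ A, z = Finsupp.single x 1})

/-- The relative singular homology group `H₀(X, A)`, with coefficients in `ℤ`: the group of relative
`0`-chains `C₀(X) / C₀(A)` (all of which are cycles) modulo the boundaries of `1`-chains. -/
abbrev RelH0 (X : Type) [TopologicalSpace X] (A : Set X) : Type :=
  (X →₀ ℤ) ⧸ relBoundaries X A

/-- Functoriality of `H₀(X, A)` in the pair `(X, A)`. -/
def RelH0.map {X Y : Type} [TopologicalSpace X] [TopologicalSpace Y] {A : Set X} {B : Set Y}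
    (f : X → Y) (hf : Continuous f) (hAB : Set.MapsTo f A B) : RelH0 X A →ₗ[ℤ] RelH0 Y B :=
  Submodule.mapQ _ _ (Finsupp.lmapDomain ℤ ℤ f) (by
    rw [relBoundaries, Submodule.span_le]
    rintro z (⟨x, y, γ, rfl⟩ | ⟨x, hx, rfl⟩)
    · refine Submodule.subset_span (Or.inl ⟨f x, f y, γ.map hf, ?_⟩)
      rw [map_sub]
      simp only [Finsupp.lmapDomain_apply, Finsupp.mapDomain_single]
    · refine Submodule.subset_span (Or.inr ⟨f x, hAB hx, ?_⟩)
      simp [Finsupp.mapDomain_single])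

theorem RelH0.map_mk_single {X Y : Type} [TopologicalSpace X] [TopologicalSpace Y]
    {A : Set X} {B : Set Y} (f : X → Y) (hf : Continuous f) (hAB : Set.MapsTo f A B) (x : X) :
    RelH0.map f hf hAB (Submodule.Quotient.mk (Finsupp.single x 1)) =
      Submodule.Quotient.mk (Finsupp.single (f x) 1) := by
  simp [RelH0.map, Submodule.mapQ_apply, Finsupp.mapDomain_single]

theorem RelH0.hom_ext {X : Type} [TopologicalSpace X] {A : Set X} {P : Type} [AddCommGroup P]
    {f g : RelH0 X A →ₗ[ℤ] P}
    (h : ∀ x : X, f (Submodule.Quotient.mk (Finsupp.single x 1)) =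
      g (Submodule.Quotient.mk (Finsupp.single x 1))) : f = g := by
  apply Submodule.linearMap_qext
  apply Finsupp.lhom_ext'
  intro x
  apply LinearMap.ext_ring
  exact h x

/-! The `FI^op`-modules `Ξ(ℓ)` -/

/-- The space of embeddings of the finite discrete set `S` into `[ℓ] ⊔ ℝ`, topologized as a subspace
of the space of all maps. -/
abbrev EmbSpace (ℓ : ℕ) (S : FI) : Type :=
  {φ : S.carrier → Fin ℓ ⊕ ℝ // Function.Injective φ}

/-- The subspace of those embeddings whose image does not contain `[ℓ]`. -/
def EmbSpace.bad (ℓ : ℕ) (S : FI) : Set (EmbSpace ℓ S) :=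
  {φ | ¬ Set.range (Sum.inl : Fin ℓ → Fin ℓ ⊕ ℝ) ⊆ Set.range φ.1}

/-- Precomposition with an injection `S → T`. -/
def EmbSpace.precomp (ℓ : ℕ) {S T : FI} (f : S ⟶ T) (φ : EmbSpace ℓ T) : EmbSpace ℓ S :=
  ⟨φ.1 ∘ FI.toFun f, φ.2.comp (FI.toFun_injective f)⟩

theorem EmbSpace.continuous_precomp (ℓ : ℕ) {S T : FI} (f : S ⟶ T) :
    Continuous (EmbSpace.precomp ℓ f) := by
  refine Continuous.subtype_mk (f := fun φ : EmbSpace ℓ T => φ.1 ∘ FI.toFun f) ?_ _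
  exact continuous_pi fun s => (continuous_apply (FI.toFun f s)).comp continuous_subtype_val

theorem EmbSpace.mapsTo_precomp (ℓ : ℕ) {S T : FI} (f : S ⟶ T) :
    Set.MapsTo (EmbSpace.precomp ℓ f) (EmbSpace.bad ℓ T) (EmbSpace.bad ℓ S) := by
  intro φ hφ h
  refine hφ (h.trans ?_)
  rintro _ ⟨s, rfl⟩
  exact ⟨FI.toFun f s, rfl⟩

/-- The `FI^op`-module `Ξ(ℓ)`, with `Ξ(ℓ)_S = H₀(X_S, A_S)`, where `X_S` is the space of embeddings
of `S` into `[ℓ] ⊔ ℝ` and `A_S` is the subspace of embeddings whose image does not contain `[ℓ]`;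
injections act by precomposition. -/
def Xi (ℓ : ℕ) : FIᵒᵖ ⥤ ModuleCat.{0} ℤ where
  obj S := ModuleCat.of ℤ (RelH0 (EmbSpace ℓ S.unop) (EmbSpace.bad ℓ S.unop))
  map f := ModuleCat.ofHom (RelH0.map (EmbSpace.precomp ℓ f.unop)
    (EmbSpace.continuous_precomp ℓ f.unop) (EmbSpace.mapsTo_precomp ℓ f.unop))
  map_id S := by
    apply ModuleCat.hom_ext
    apply RelH0.hom_ext
    intro x
    exact RelH0.map_mk_single (EmbSpace.precomp ℓ (𝟙 S.unop)) (EmbSpace.continuous_precomp ℓ _)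
      (EmbSpace.mapsTo_precomp ℓ _) x
  map_comp f g := by
    apply ModuleCat.hom_ext
    apply RelH0.hom_ext
    intro x
    have h1 := RelH0.map_mk_single (EmbSpace.precomp ℓ f.unop)
      (EmbSpace.continuous_precomp ℓ f.unop) (EmbSpace.mapsTo_precomp ℓ f.unop) x
    have h2 := RelH0.map_mk_single (EmbSpace.precomp ℓ g.unop)
      (EmbSpace.continuous_precomp ℓ g.unop) (EmbSpace.mapsTo_precomp ℓ g.unop)
      (EmbSpace.precomp ℓ f.unop x)
    have h3 := RelH0.map_mk_single (EmbSpace.precomp ℓ (f ≫ g).unop)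
      (EmbSpace.continuous_precomp ℓ _) (EmbSpace.mapsTo_precomp ℓ _) x
    refine h3.trans ?_
    simp only [ModuleCat.hom_comp, ModuleCat.hom_ofHom, LinearMap.comp_apply]
    exact ((congrArg _ h1).trans h2).symm

/-! The functor tensor product and the tail invariants -/

section Tensor

variable {R : Type u} [CommRing R]

/-- The direct sum of the `M_n ⊗ N_n` over all `n`. -/
abbrev TensorSum (M : FI ⥤ ModuleCat.{v} R) (N : FIᵒᵖ ⥤ ModuleCat.{0} ℤ) : Type v :=
  ⨁ n : ℕ, (M.obj (FI.std n) ⊗[ℤ] N.obj (Opposite.op (FI.std n)))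

/-- The element `m ⊗ ξ` of the `n`-th summand. -/
def TensorSum.tmul (M : FI ⥤ ModuleCat.{v} R) (N : FIᵒᵖ ⥤ ModuleCat.{0} ℤ) (n : ℕ)
    (m : M.obj (FI.std n)) (ξ : N.obj (Opposite.op (FI.std n))) : TensorSum M N :=
  DirectSum.lof R ℕ
    (fun n : ℕ => (M.obj (FI.std n) ⊗[ℤ] N.obj (Opposite.op (FI.std n)))) n (m ⊗ₜ[ℤ] ξ)

/-- The functor tensor product `M ⊗_FI N`, an `R`-module: the quotient of `⨁ n, M_n ⊗ N_n` by the
relations `m f ⊗ ξ = m ⊗ f ξ` for all injections `f : [p] → [q]`, `m ∈ M_p` and `ξ ∈ N_q`. -/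
abbrev TensorFI (M : FI ⥤ ModuleCat.{v} R) (N : FIᵒᵖ ⥤ ModuleCat.{0} ℤ) : Type v :=
  TensorSum M N ⧸ Submodule.span R
    {z : TensorSum M N | ∃ (p q : ℕ) (f : FI.std p ⟶ FI.std q) (m : M.obj (FI.std p))
      (ξ : N.obj (Opposite.op (FI.std q))),
      z = TensorSum.tmul M N q ((M.map f).hom m) ξ - TensorSum.tmul M N p m ((N.map f.op).hom ξ)}

/-- The `ℓ`-th tail invariant `A_ℓ = M ⊗_FI Ξ(ℓ)`. -/
abbrev TailInvariant (M : FI ⥤ ModuleCat.{v} R) (ℓ : ℕ) : Type v := TensorFI M (Xi ℓ)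

end Tensor

/-! Differences of binomial coefficients, and Hilbert polynomials -/

/-- The integer `C(n, ℓ) - C(n, ℓ - 1)`, where `C(n, -1) = 0`. -/
def binomDiff (n : ℕ) : ℕ → ℤ
  | 0 => n.choose 0
  | ℓ + 1 => n.choose (ℓ + 1) - n.choose ℓ

/-- The binomial coefficient `C(X, ℓ) = X (X - 1) ⋯ (X - ℓ + 1) / ℓ!` as a polynomial. -/
def binomPoly (ℓ : ℕ) : ℚ[X] := Polynomial.C ((ℓ.factorial : ℚ)⁻¹) * descPochhammer ℚ ℓ

/-- The polynomial `C(X, ℓ) - C(X, ℓ - 1)`, where `C(X, -1) = 0`. -/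
def binomDiffPoly : ℕ → ℚ[X]
  | 0 => binomPoly 0
  | ℓ + 1 => binomPoly (ℓ + 1) - binomPoly ℓ

/-- `P` is a Hilbert polynomial of `M`: it eventually coincides with the Hilbert function
`n ↦ dim M_n`. -/
def IsHilbertPolynomial {R : Type u} [CommRing R] (M : FI ⥤ ModuleCat.{v} R) (P : ℚ[X]) : Prop :=
  ∀ᶠ n : ℕ in atTop, (Module.finrank R (M.obj (FI.std n)) : ℚ) = P.eval (n : ℚ)

end

/-! An embedding of `S` into `[ℓ] ⊔ ℝ` that hits all of `[ℓ]` is determined up to isotopy by an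
enumeration of `S`: first the preimages of `[ℓ]`, then the points in `ℝ` from left to right. So
`Ξ(ℓ)_S` is free on the enumerations of `S` if `ℓ ≤ |S|`, and `0` otherwise.

Reading a standard Young tableau with `n` entries and second row of length `ℓ` along the second row
backwards and then along the first row enumerates `[n]`, which gives an element of `Ξ(ℓ)_n`, that
is, a map `ℤ FI(-, [n]) → Ξ(ℓ)`. For `2 d ≤ n + 1`, the resulting map from `ℤ FI(-, [n])` to the
product of the `Ξ(ℓ)` over all such tableaux with `ℓ ≤ d` is bijective in degrees `k ≤ d`: it is
surjective, by an induction that removes the last entry of the tableaux, and both sides have rank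
`k! C(n, k)`. Tensoring with `M` only sees these degrees, and `M ⊗_FI ℤ FI(-, [n]) = M_n`. -/

noncomputable section

/-! Differences of binomial coefficients -/

theorem binomDiff_succ_succ (n ℓ : ℕ) :
    binomDiff (n + 1) (ℓ + 1) = binomDiff n (ℓ + 1) + binomDiff n ℓ := by
  rcases ℓ with - | ℓ
  · simp [binomDiff]
  · simp only [binomDiff, Nat.choose_succ_succ' n]
    push_cast
    ring

theorem binomDiff_pos {n ℓ : ℕ} (h : 2 * ℓ ≤ n) : 0 < binomDiff n ℓ := by
  rcases ℓ with - | ℓ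
  · simp [binomDiff]
  · rw [binomDiff, sub_pos, Nat.cast_lt]
    have hstep := Nat.choose_succ_right_eq n ℓ
    have hlt : n.choose ℓ * (ℓ + 1) < n.choose ℓ * (n - ℓ) :=
      Nat.mul_lt_mul_of_pos_left (by omega) (Nat.choose_pos (by omega))
    exact Nat.lt_of_mul_lt_mul_right (hlt.trans_eq hstep.symm)

theorem sum_binomDiff (n k : ℕ) :
    ∑ ℓ ∈ Finset.range (k + 1), binomDiff n ℓ = n.choose k := by
  induction k with
  | zero => simp [binomDiff]
  | succ k ih => rw [Finset.sum_range_succ, ih, binomDiff, add_sub_cancel]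

/-! Enumerations of finite sets -/

/-- The list `l` is an enumeration of `α`, without repetitions. -/
def IsEnum {α : Type*} (l : List α) : Prop := l.Nodup ∧ ∀ a, a ∈ l

theorem IsEnum.length_eq {α : Type*} [Fintype α] {l : List α} (h : IsEnum l) :
    l.length = Fintype.card α := by
  classical
  rw [← List.toFinset_card_of_nodup h.1, ← Finset.card_univ]
  congr 1
  ext a
  simp [h.2 a]

theorem IsEnum.filterMap_partialInv {α β : Type*} {l : List α} (h : IsEnum l) {f : β → α}
    (hf : f.Injective) : IsEnum (l.filterMap (Function.partialInv f)) := by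
  refine ⟨h.1.filterMap fun a a' b hb hb' => ?_, fun b => ?_⟩
  · rw [Option.mem_def, hf.isPartialInv] at hb hb'
    exact hb.symm.trans hb'
  · exact List.mem_filterMap.2 ⟨f b, h.2 _, Function.partialInv_left hf b⟩

theorem IsEnum.exists_partialInv_eq {α β : Type*} {l : List α} {v : α → Option β} (hl : IsEnum l)
    (h : IsEnum (l.filterMap v)) : ∃ f : β → α, f.Injective ∧ Function.partialInv f = v := by
  have : Std.Symm fun a a' => ∀ b, v a = some b → ∀ b', v a' = some b' → b ≠ b' :=
    ⟨fun _ _ h b hb b' hb' => (h b' hb' b hb).symm⟩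
  have hv : ∀ {a a' b}, v a = some b → v a' = some b → a = a' := fun {a a' b} ha ha' => by
    by_contra hne
    exact (List.pairwise_filterMap.1 h.1).forall (hl.2 a) (hl.2 a') hne b ha b ha' rfl
  have hex : ∀ b, ∃ a, v a = some b := fun b => by
    obtain ⟨a, -, ha⟩ := List.mem_filterMap.1 (h.2 b)
    exact ⟨a, ha⟩
  choose f hf using hex
  have hf_inj : f.Injective := fun b b' hbb' => Option.some_injective _ <| by
    rw [← hf, ← hf, hbb']
  refine ⟨f, hf_inj, funext fun a => Option.ext fun b => ?_⟩
  rw [hf_inj.isPartialInv b a]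
  exact ⟨fun h => h ▸ hf b, hv (hf b)⟩

theorem natCard_isEnum (k : ℕ) : Nat.card {l : List (Fin k) // IsEnum l} = k.factorial := by
  have h : ∀ l : List (Fin k), IsEnum l ↔ l ∈ (List.finRange k).permutations.toFinset := by
    intro l
    rw [List.mem_toFinset, List.mem_permutations]
    exact ⟨fun h => (List.perm_ext_iff_of_nodup h.1 (List.nodup_finRange k)).2 fun a => by
      simp [h.2 a], fun h => ⟨h.nodup_iff.2 (List.nodup_finRange k), fun a => by
      simp [h.mem_iff]⟩⟩
  rw [Nat.card_congr (Equiv.subtypeEquivRight h), Nat.card_eq_fintype_card, Fintype.card_coe,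
    List.toFinset_card_of_nodup (List.nodup_permutations _ (List.nodup_finRange k)),
    List.length_permutations, List.length_finRange]

/-! Path components of spaces of embeddings -/

namespace EmbSpace

variable {ℓ : ℕ} {S : FI}

theorem notMem_bad_iff {ψ : EmbSpace ℓ S} : ψ ∉ bad ℓ S ↔ ∀ j, ∃ a, ψ.1 a = Sum.inl j := by
  simp [bad, Set.range_subset_iff]

/-- The list `l` enumerates `S` in the order of the images in `[ℓ] ⊔ ℝ`, where all elements of `[ℓ]`
come first. -/
def IsWord (ψ : EmbSpace ℓ S) (l : List S.carrier) : Prop :=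
  (∀ a, a ∈ l) ∧ l.Pairwise fun a b => toLex (ψ.1 a) < toLex (ψ.1 b)

section IsWord

variable {ψ ψ' : EmbSpace ℓ S} {l l' : List S.carrier}

theorem IsWord.isEnum (h : IsWord ψ l) : IsEnum l :=
  ⟨h.2.imp fun hab => by rintro rfl; exact lt_irrefl _ hab, h.1⟩

theorem exists_isWord (ψ : EmbSpace ℓ S) : ∃ l, IsWord ψ l := by
  have := S.finite
  let := Fintype.ofFinite S.carrier
  let : LinearOrder S.carrier :=
    LinearOrder.lift' (fun a => toLex (ψ.1 a)) (toLex.injective.comp ψ.2)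
  exact ⟨Finset.univ.sort (· ≤ ·), fun a => by simp only [Finset.mem_sort, Finset.mem_univ],
    (Finset.sortedLT_sort (Finset.univ : Finset S.carrier)).pairwise⟩

theorem IsWord.unique (h : IsWord ψ l) (h' : IsWord ψ l') : l = l' :=
  List.Perm.eq_of_pairwise (fun _ _ _ _ h1 h2 => absurd h1 h2.asymm) h.2 h'.2
    ((List.perm_ext_iff_of_nodup h.isEnum.1 h'.isEnum.1).2 fun a => by simp only [h.1 a, h'.1 a])

/-- The elements of `S` in the order of their images under `ψ`. -/
def word (ψ : EmbSpace ℓ S) : List S.carrier := Classical.choose (exists_isWord ψ)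

theorem isWord_word (ψ : EmbSpace ℓ S) : IsWord ψ (word ψ) :=
  Classical.choose_spec (exists_isWord ψ)

theorem IsWord.map_eq (h : IsWord ψ l) (hψ : ψ ∉ bad ℓ S) :
    l.map ψ.1 = (List.finRange ℓ).map Sum.inl ++ (l.map ψ.1).filter Sum.isRight := by
  have hl : (l.map ψ.1).Pairwise fun x y => toLex x < toLex y := List.pairwise_map.2 h.2
  have hr : ((List.finRange ℓ).map Sum.inl ++ (l.map ψ.1).filter Sum.isRight).Pairwise
      fun x y => toLex x < toLex y := by
    refine List.pairwise_append.2 ⟨List.pairwise_map.2 ?_, hl.filter _, ?_⟩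
    · exact (List.pairwise_lt_finRange ℓ).imp Sum.Lex.inl_lt_inl_iff.2
    · intro x hx y hy
      obtain ⟨i, -, rfl⟩ := List.mem_map.1 hx
      obtain ⟨r, rfl⟩ := Sum.isRight_iff.1 (List.mem_filter.1 hy).2
      exact Sum.Lex.inl_lt_inr i r
  have hne : ∀ {x y : Fin ℓ ⊕ ℝ}, toLex x < toLex y → x ≠ y := fun hxy h => hxy.ne (h ▸ rfl)
  refine List.Perm.eq_of_pairwise (fun _ _ _ _ h1 h2 => absurd h1 h2.asymm) hl hr
    ((List.perm_ext_iff_of_nodup (hl.imp hne) (hr.imp hne)).2 fun x => ?_)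
  rcases x with i | r
  · obtain ⟨a, ha⟩ := notMem_bad_iff.1 hψ i
    simpa using ⟨a, h.1 a, ha⟩
  · simp

theorem IsWord.le_length (h : IsWord ψ l) (hψ : ψ ∉ bad ℓ S) : ℓ ≤ l.length := by
  simpa using (congrArg List.length (h.map_eq hψ)).ge.trans' (by simp)

theorem IsWord.apply_getElem_of_lt (h : IsWord ψ l) (hψ : ψ ∉ bad ℓ S) {i : ℕ} (hi : i < l.length)
    (hiℓ : i < ℓ) : ψ.1 l[i] = Sum.inl ⟨i, hiℓ⟩ := by
  have := List.getElem_of_eq (h.map_eq hψ) (i := i) (by simpa using hi)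
  simpa [List.getElem_append, hiℓ] using this

theorem IsWord.exists_apply_getElem_of_le (h : IsWord ψ l) (hψ : ψ ∉ bad ℓ S) {i : ℕ}
    (hi : i < l.length) (hiℓ : ℓ ≤ i) : ∃ r, ψ.1 l[i] = Sum.inr r := by
  rcases hr : ψ.1 l[i] with j | r
  · have hj : (j : ℕ) < l.length := j.2.trans_le (hiℓ.trans hi.le)
    have hij := ψ.2 (hr.trans (h.apply_getElem_of_lt hψ hj j.2).symm)
    exact absurd ((h.isEnum.1.getElem_inj_iff).1 hij) (j.2.trans_le hiℓ).ne'
  · exact ⟨r, rfl⟩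

end IsWord

theorem isOpen_singleton_inl (j : Fin ℓ) : IsOpen {(Sum.inl j : Fin ℓ ⊕ ℝ)} := by
  simpa only [Set.image_singleton] using
    (Topology.IsOpenEmbedding.inl (X := Fin ℓ) (Y := ℝ)).isOpenMap {j} (isOpen_discrete _)

theorem isOpen_toLex_lt (ℓ : ℕ) :
    IsOpen {z : (Fin ℓ ⊕ ℝ) × (Fin ℓ ⊕ ℝ) | toLex z.1 < toLex z.2} := by
  rw [isOpen_iff_forall_mem_open]
  rintro ⟨x | x, y | y⟩ h
  · refine ⟨{Sum.inl x} ×ˢ {Sum.inl y}, ?_,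
      (isOpen_singleton_inl x).prod (isOpen_singleton_inl y), rfl, rfl⟩
    rintro ⟨_, _⟩ ⟨rfl, rfl⟩
    exact h
  · refine ⟨Set.range Sum.inl ×ˢ Set.range Sum.inr, ?_, isOpen_range_inl.prod isOpen_range_inr,
      ⟨x, rfl⟩, ⟨y, rfl⟩⟩
    rintro ⟨_, _⟩ ⟨⟨i, rfl⟩, ⟨z, rfl⟩⟩
    exact Sum.Lex.inl_lt_inr _ _
  · exact absurd h Sum.Lex.not_inr_lt_inl
  · refine ⟨Prod.map Sum.inr Sum.inr '' {z : ℝ × ℝ | z.1 < z.2}, ?_, ?_, ?_⟩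
    · rintro _ ⟨z, hz, rfl⟩
      exact Sum.Lex.inr_lt_inr_iff.2 hz
    · exact (Topology.IsOpenEmbedding.inr.prodMap Topology.IsOpenEmbedding.inr).isOpenMap _
        (isOpen_lt continuous_fst continuous_snd)
    · exact ⟨(x, y), Sum.Lex.inr_lt_inr_iff.1 h, rfl⟩

theorem continuous_eval (a : S.carrier) : Continuous fun ψ : EmbSpace ℓ S => ψ.1 a :=
  (continuous_apply a).comp continuous_subtype_val

theorem isClopen_setOf_lt (a b : S.carrier) :
    IsClopen {ψ : EmbSpace ℓ S | toLex (ψ.1 a) < toLex (ψ.1 b)} := by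
  have ho : ∀ a b, IsOpen {ψ : EmbSpace ℓ S | toLex (ψ.1 a) < toLex (ψ.1 b)} := fun a b =>
    (isOpen_toLex_lt ℓ).preimage ((continuous_eval a).prodMk (continuous_eval b))
  refine ⟨?_, ho a b⟩
  by_cases hab : a = b
  · subst hab
    simp only [lt_irrefl, Set.ofPred_false, isClosed_empty]
  · convert (ho b a).isClosed_compl using 1
    ext ψ
    simp only [Set.mem_ofPred_eq, Set.mem_compl_iff, not_lt]
    exact lt_iff_le_and_ne.trans (and_iff_left fun h => hab (ψ.2 (toLex.injective h)))

theorem isClopen_setOf_eq_inl (a : S.carrier) (j : Fin ℓ) :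
    IsClopen {ψ : EmbSpace ℓ S | ψ.1 a = Sum.inl j} :=
  IsClopen.preimage ⟨isClosed_singleton, isOpen_singleton_inl j⟩ (continuous_eval a)

theorem mem_iff_of_path {ψ ψ' : EmbSpace ℓ S} (γ : Path ψ ψ') {s : Set (EmbSpace ℓ S)}
    (hs : IsClopen s) : ψ ∈ s ↔ ψ' ∈ s := by
  have h : ∀ {x y : EmbSpace ℓ S}, Path x y → x ∈ s → y ∈ s := fun γ hx =>
    (isPreconnected_range γ.continuous).subset_isClopen hs ⟨_, ⟨0, γ.source⟩, hx⟩ ⟨1, γ.target⟩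
  exact ⟨h γ, h γ.symm⟩

theorem mem_bad_iff_of_path {ψ ψ' : EmbSpace ℓ S} (γ : Path ψ ψ') :
    ψ ∈ bad ℓ S ↔ ψ' ∈ bad ℓ S := by
  rw [← not_iff_not, notMem_bad_iff, notMem_bad_iff]
  exact forall_congr' fun j => exists_congr fun a =>
    mem_iff_of_path γ (isClopen_setOf_eq_inl a j)

theorem word_eq_of_path {ψ ψ' : EmbSpace ℓ S} (γ : Path ψ ψ') : word ψ = word ψ' := by
  refine IsWord.unique (ψ := ψ') ⟨(isWord_word ψ).1, (isWord_word ψ).2.imp ?_⟩ (isWord_word ψ')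
  exact fun {a b} => (mem_iff_of_path γ (isClopen_setOf_lt a b)).1

/-- The straight path from `ψ` to `ψ'` on the points that `ψ` maps to `ℝ`, constant on the others.
It is used when the others are the same for `ψ'`; the value `0` is junk. -/
def interp (ψ ψ' : EmbSpace ℓ S) (τ : ℝ) (a : S.carrier) : Fin ℓ ⊕ ℝ :=
  (ψ.1 a).map id fun x => (1 - τ) * x + τ * (ψ'.1 a).elim (fun _ => (0 : ℝ)) id

section interp

variable {ψ ψ' : EmbSpace ℓ S} {l : List S.carrier}

theorem interp_getElem_of_lt (h : IsWord ψ l) (hψ : ψ ∉ bad ℓ S) (τ : ℝ) {i : ℕ}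
    (hi : i < l.length) (hiℓ : i < ℓ) : interp ψ ψ' τ l[i] = Sum.inl ⟨i, hiℓ⟩ := by
  rw [interp, h.apply_getElem_of_lt hψ hi hiℓ, Sum.map_inl, id]

theorem pairwise_interp_lt (h : IsWord ψ l) (h' : IsWord ψ' l) (hψ : ψ ∉ bad ℓ S)
    (hψ' : ψ' ∉ bad ℓ S) (τ : unitInterval) :
    l.Pairwise fun a b => toLex (interp ψ ψ' τ a) < toLex (interp ψ ψ' τ b) := by
  rw [List.pairwise_iff_getElem]
  intro i j hi hj hij
  have hlt := List.pairwise_iff_getElem.1 h.2 i j hi hj hij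
  have hlt' := List.pairwise_iff_getElem.1 h'.2 i j hi hj hij
  rcases lt_or_ge j ℓ with hjℓ | hjℓ
  · rw [interp_getElem_of_lt h hψ _ hi (hij.trans hjℓ), interp_getElem_of_lt h hψ _ hj hjℓ]
    exact Sum.Lex.inl_lt_inl_iff.2 hij
  obtain ⟨y, hy⟩ := h.exists_apply_getElem_of_le hψ hj hjℓ
  obtain ⟨y', hy'⟩ := h'.exists_apply_getElem_of_le hψ' hj hjℓ
  rcases lt_or_ge i ℓ with hiℓ | hiℓ
  · rw [interp_getElem_of_lt h hψ _ hi hiℓ, interp, hy, Sum.map_inr]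
    exact Sum.Lex.inl_lt_inr _ _
  obtain ⟨x, hx⟩ := h.exists_apply_getElem_of_le hψ hi hiℓ
  obtain ⟨x', hx'⟩ := h'.exists_apply_getElem_of_le hψ' hi hiℓ
  rw [hx, hy, Sum.Lex.inr_lt_inr_iff] at hlt
  rw [hx', hy', Sum.Lex.inr_lt_inr_iff] at hlt'
  simp only [interp, hx, hy, hx', hy', Sum.map_inr, Sum.elim_inr, id, Sum.Lex.inr_lt_inr_iff]
  obtain ⟨τ, h0, h1⟩ := τ
  rcases h0.eq_or_lt with rfl | h0
  · simpa using hlt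
  · linarith [mul_lt_mul_of_pos_left hlt' h0, mul_le_mul_of_nonneg_left hlt.le (sub_nonneg.2 h1)]

theorem injective_interp (h : IsWord ψ l) (h' : IsWord ψ' l) (hψ : ψ ∉ bad ℓ S)
    (hψ' : ψ' ∉ bad ℓ S) (τ : unitInterval) : Function.Injective (interp ψ ψ' τ) := fun a b hab =>
  List.inj_on_of_nodup_map (List.pairwise_map.2 ((pairwise_interp_lt h h' hψ hψ' τ).imp
    fun hlt heq => hlt.ne (congrArg toLex heq))) (h.1 a) (h.1 b) hab

theorem continuous_interp (ψ ψ' : EmbSpace ℓ S) : Continuous (interp ψ ψ') := by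
  refine continuous_pi fun a => ?_
  simp only [interp]
  rcases ψ.1 a with i | x
  · exact continuous_const
  · exact continuous_inr.comp (by fun_prop)

theorem interp_zero (ψ ψ' : EmbSpace ℓ S) : interp ψ ψ' 0 = ψ.1 := by
  funext a
  rcases h : ψ.1 a with i | x <;> simp [interp, h]

theorem interp_one (h : IsWord ψ l) (h' : IsWord ψ' l) (hψ : ψ ∉ bad ℓ S) (hψ' : ψ' ∉ bad ℓ S) :
    interp ψ ψ' 1 = ψ'.1 := by
  funext a
  obtain ⟨i, hi, rfl⟩ := List.mem_iff_getElem.1 (h.1 a)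
  rcases lt_or_ge i ℓ with hiℓ | hiℓ
  · rw [interp_getElem_of_lt h hψ _ hi hiℓ, h'.apply_getElem_of_lt hψ' hi hiℓ]
  · obtain ⟨x, hx⟩ := h.exists_apply_getElem_of_le hψ hi hiℓ
    obtain ⟨x', hx'⟩ := h'.exists_apply_getElem_of_le hψ' hi hiℓ
    simp [interp, hx, hx']

theorem nonempty_path (h : IsWord ψ l) (h' : IsWord ψ' l) (hψ : ψ ∉ bad ℓ S)
    (hψ' : ψ' ∉ bad ℓ S) : Nonempty (Path ψ ψ') :=
  ⟨{ toFun := fun τ => ⟨interp ψ ψ' τ, injective_interp h h' hψ hψ' τ⟩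
     continuous_toFun := ((continuous_interp ψ ψ').comp continuous_subtype_val).subtype_mk _
     source' := Subtype.ext (interp_zero ψ ψ')
     target' := Subtype.ext (interp_one h h' hψ hψ') }⟩

end interp

/-! A basis of `H₀` -/

/-- The class of a point in `H₀`. -/
def cls (ψ : EmbSpace ℓ S) : RelH0 (EmbSpace ℓ S) (bad ℓ S) :=
  Submodule.Quotient.mk (Finsupp.single ψ 1)

theorem cls_eq_zero {ψ : EmbSpace ℓ S} (h : ψ ∈ bad ℓ S) : cls ψ = 0 :=
  (Submodule.Quotient.mk_eq_zero _).2 (Submodule.subset_span (Or.inr ⟨ψ, h, rfl⟩))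

theorem cls_eq_cls {ψ ψ' : EmbSpace ℓ S} {l : List S.carrier} (h : IsWord ψ l) (h' : IsWord ψ' l)
    (hψ : ψ ∉ bad ℓ S) (hψ' : ψ' ∉ bad ℓ S) : cls ψ = cls ψ' := by
  obtain ⟨γ⟩ := nonempty_path h' h hψ' hψ
  exact (Submodule.Quotient.eq _).2 (Submodule.subset_span (Or.inl ⟨_, _, γ, rfl⟩))

/-- The image of the `i`-th point in the embedding that belongs to an enumeration. -/
def place (ℓ i : ℕ) : Fin ℓ ⊕ ℝ := if h : i < ℓ then Sum.inl ⟨i, h⟩ else Sum.inr i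

theorem place_lt_place {i j : ℕ} (h : i < j) : toLex (place ℓ i) < toLex (place ℓ j) := by
  unfold place
  split_ifs with hi hj hj
  · exact Sum.Lex.inl_lt_inl_iff.2 h
  · exact Sum.Lex.inl_lt_inr _ _
  · omega
  · exact Sum.Lex.inr_lt_inr_iff.2 (Nat.cast_lt.2 h)

theorem injective_place (ℓ : ℕ) : Function.Injective (place ℓ) := fun i j h => by
  by_contra hne
  rcases lt_or_gt_of_ne hne with hij | hij
  · exact (place_lt_place hij).ne (congrArg toLex h)
  · exact (place_lt_place hij).ne' (congrArg toLex h)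

open Classical in
/-- The embedding that sends the first `ℓ` entries of the enumeration `l` to `[ℓ]`, in this order,
and the other ones to increasing real numbers. -/
def ofEnum (ℓ : ℕ) (l : List S.carrier) (hl : IsEnum l) : EmbSpace ℓ S :=
  ⟨fun a => place ℓ (l.idxOf a),
    fun a _ h => (List.idxOf_inj (hl.2 a)).1 (injective_place ℓ h)⟩

section ofEnum

variable {l : List S.carrier} (hl : IsEnum l)

open Classical in
theorem ofEnum_getElem {i : ℕ} (hi : i < l.length) : (ofEnum ℓ l hl).1 l[i] = place ℓ i :=
  congrArg (place ℓ) (hl.1.idxOf_getElem i hi)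

theorem isWord_ofEnum (ℓ : ℕ) : IsWord (ofEnum ℓ l hl) l := by
  refine ⟨hl.2, List.pairwise_iff_getElem.2 fun i j hi hj hij => ?_⟩
  rw [ofEnum_getElem, ofEnum_getElem]
  exact place_lt_place hij

theorem ofEnum_eq_inl_iff {a : S.carrier} {j : Fin ℓ} :
    (ofEnum ℓ l hl).1 a = Sum.inl j ↔ l[(j : ℕ)]? = some a := by
  obtain ⟨i, hi, rfl⟩ := List.mem_iff_getElem.1 (hl.2 a)
  rw [ofEnum_getElem, show Sum.inl j = place ℓ j by simp [place], (injective_place ℓ).eq_iff,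
    List.getElem?_eq_some_iff]
  exact ⟨fun h => ⟨h ▸ hi, by simp only [h]⟩, fun ⟨_, h⟩ => (hl.1.getElem_inj_iff.1 h).symm⟩

theorem ofEnum_notMem_bad (hℓ : ℓ ≤ l.length) : ofEnum ℓ l hl ∉ bad ℓ S :=
  notMem_bad_iff.2 fun j => ⟨l[(j : ℕ)]'(j.2.trans_le hℓ), by
    rw [ofEnum_eq_inl_iff, List.getElem?_eq_getElem]⟩

end ofEnum

/-- The enumerations of `S` with at least `ℓ` entries. -/
abbrev LongEnum (ℓ : ℕ) (S : FI) : Type := {l : List S.carrier // IsEnum l ∧ ℓ ≤ l.length}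

open Classical in
/-- The coordinates of an element of `H₀` with respect to the classes of enumerations. -/
def coords (ℓ : ℕ) (S : FI) : RelH0 (EmbSpace ℓ S) (bad ℓ S) →ₗ[ℤ] LongEnum ℓ S →₀ ℤ :=
  Submodule.liftQ _
    (Finsupp.linearCombination ℤ fun ψ => if h : ψ ∈ bad ℓ S then 0 else
      Finsupp.single ⟨word ψ, (isWord_word ψ).isEnum, (isWord_word ψ).le_length h⟩ 1) <| by
    rw [relBoundaries, Submodule.span_le]
    rintro z (⟨x, x', γ, rfl⟩ | ⟨x, hx, rfl⟩)
    · simp [mem_bad_iff_of_path γ, word_eq_of_path γ]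
    · simp [hx]

theorem coords_cls {ψ : EmbSpace ℓ S} {l : List S.carrier} (h : IsWord ψ l) (hψ : ψ ∉ bad ℓ S) :
    coords ℓ S (cls ψ) = Finsupp.single ⟨l, h.isEnum, h.le_length hψ⟩ 1 := by
  obtain rfl := h.unique (isWord_word ψ)
  simp [coords, cls, hψ]

/-- The classes of the enumerations of `S` with at least `ℓ` entries form a basis of
`H₀(X_S, A_S)`. -/
def basis (ℓ : ℕ) (S : FI) : Module.Basis (LongEnum ℓ S) ℤ (RelH0 (EmbSpace ℓ S) (bad ℓ S)) :=
  .ofRepr <| LinearEquiv.ofLinearMap (coords ℓ S)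
    (Finsupp.linearCombination ℤ fun l => cls (ofEnum ℓ l.1 l.2.1))
    (Finsupp.lhom_ext' fun l => LinearMap.ext_ring <| by
      simp [coords_cls (isWord_ofEnum l.2.1 ℓ) (ofEnum_notMem_bad l.2.1 l.2.2)])
    (RelH0.hom_ext fun ψ => by
      change Finsupp.linearCombination ℤ _ (coords ℓ S (cls ψ)) = cls ψ
      by_cases hψ : ψ ∈ bad ℓ S
      · rw [cls_eq_zero hψ, map_zero, map_zero]
      · have hw := isWord_word ψ
        rw [coords_cls hw hψ, Finsupp.linearCombination_single, one_smul]
        exact cls_eq_cls (isWord_ofEnum hw.isEnum ℓ) hw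
          (ofEnum_notMem_bad hw.isEnum (hw.le_length hψ)) hψ)

theorem cls_eq_basis {ψ : EmbSpace ℓ S} {l : List S.carrier} (h : IsWord ψ l) (hψ : ψ ∉ bad ℓ S) :
    cls ψ = basis ℓ S ⟨l, h.isEnum, h.le_length hψ⟩ :=
  (basis ℓ S).repr.injective <| by
    rw [Module.Basis.repr_self]
    exact coords_cls h hψ

theorem finrank_relH0_std (ℓ k : ℕ) :
    Module.finrank ℤ (RelH0 (EmbSpace ℓ (FI.std k)) (bad ℓ (FI.std k))) =
      if ℓ ≤ k then k.factorial else 0 := by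
  have hlen : ∀ l : List (Fin k), IsEnum l → l.length = k := fun l hl =>
    hl.length_eq.trans (Fintype.card_fin k)
  rw [Module.finrank_eq_nat_card_basis (basis ℓ (FI.std k)), ← natCard_isEnum]
  split_ifs with h
  · exact Nat.card_congr (Equiv.subtypeEquivRight fun l => and_iff_left_of_imp fun hl =>
      h.trans (hlen l hl).ge)
  · have : IsEmpty (LongEnum ℓ (FI.std k)) := ⟨fun l => h (l.2.2.trans (hlen _ l.2.1).le)⟩
    exact Nat.card_of_isEmpty

/-! Precomposition -/

theorem IsWord.precomp {T : FI} {ψ : EmbSpace ℓ T} {l : List T.carrier} (h : IsWord ψ l)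
    (f : S ⟶ T) : IsWord (precomp ℓ f ψ) (l.filterMap (Function.partialInv (FI.toFun f))) := by
  have hf := FI.toFun_injective f
  refine ⟨(h.isEnum.filterMap_partialInv hf).2, List.pairwise_filterMap.2 (h.2.imp ?_)⟩
  intro a b hab a' ha' b' hb'
  rw [hf.isPartialInv] at ha' hb'
  subst ha' hb'
  exact hab

theorem precomp_ofEnum_notMem_bad_iff {T : FI} {l : List T.carrier} (hl : IsEnum l)
    (hℓ : ℓ ≤ l.length) (f : S ⟶ T) : precomp ℓ f (ofEnum ℓ l hl) ∉ bad ℓ S ↔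
      ∀ p ∈ l.take ℓ, (Function.partialInv (FI.toFun f) p).isSome := by
  have hsome : ∀ p, (Function.partialInv (FI.toFun f) p).isSome ↔ ∃ a, FI.toFun f a = p := by
    intro p
    simp only [Option.isSome_iff_exists, (FI.toFun_injective f).isPartialInv _ p]
  have hinl : ∀ (j : Fin ℓ) a, (precomp ℓ f (ofEnum ℓ l hl)).1 a = Sum.inl j ↔
      FI.toFun f a = l[(j : ℕ)]'(j.2.trans_le hℓ) := fun j a => by
    rw [eq_comm (a := FI.toFun f a), ← Option.some_inj (a := l[(j : ℕ)]'_),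
      ← List.getElem?_eq_getElem]
    exact ofEnum_eq_inl_iff hl
  simp only [notMem_bad_iff, hsome, hinl, List.mem_take_iff_getElem]
  exact ⟨fun h p ⟨j, hj, hp⟩ => hp ▸ h ⟨j, hj.trans_le (min_le_left _ _)⟩,
    fun h j => h _ ⟨j, lt_min j.2 (j.2.trans_le hℓ), rfl⟩⟩

end EmbSpace

/-! Two-row tableaux -/

/-- A filling of a two-row diagram by `0, …, n - 1`, increasing along both rows, built up by adding
the entries one by one at the end of the first or of the second row. -/
inductive TwoRowFilling : ℕ → Type
  | empty : TwoRowFilling 0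
  | addFirst {n : ℕ} (t : TwoRowFilling n) : TwoRowFilling (n + 1)
  | addSecond {n : ℕ} (t : TwoRowFilling n) : TwoRowFilling (n + 1)

namespace TwoRowFilling

/-- Deleting the last entry and remembering its row. -/
def succEquiv (n : ℕ) : TwoRowFilling (n + 1) ≃ TwoRowFilling n ⊕ TwoRowFilling n where
  toFun
    | addFirst t => .inl t
    | addSecond t => .inr t
  invFun := Sum.elim addFirst addSecond
  left_inv t := by cases t <;> rfl
  right_inv t := by cases t <;> rfl

instance : Unique (TwoRowFilling 0) where
  default := empty
  uniq t := by cases t; rfl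

instance : ∀ n, Fintype (TwoRowFilling n)
  | 0 => inferInstance
  | n + 1 =>
    letI := instFintype n
    Fintype.ofEquiv _ (succEquiv n).symm

theorem sum_succ {n : ℕ} {B : Type*} [AddCommMonoid B] (F : TwoRowFilling (n + 1) → B) :
    ∑ t, F t = ∑ t : TwoRowFilling n, F t.addFirst + ∑ t : TwoRowFilling n, F t.addSecond := by
  rw [← (succEquiv n).symm.sum_comp, Fintype.sum_sum_type]
  rfl

/-- The length of the second row. -/
def deg : ∀ {n}, TwoRowFilling n → ℕ
  | _, empty => 0
  | _, addFirst t => t.deg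
  | _, addSecond t => t.deg + 1

/-- The filling is a standard Young tableau: at each stage, the second row is at most as long as
the first one. -/
def IsBallot : ∀ {n}, TwoRowFilling n → Prop
  | _, empty => True
  | _, addFirst t => t.IsBallot
  | n + 1, addSecond t => t.IsBallot ∧ 2 * (t.deg + 1) ≤ n + 1

/-- The second row from right to left, followed by the first row from left to right. -/
def reading : ∀ {n}, TwoRowFilling n → List (Fin n)
  | _, empty => []
  | n + 1, addFirst t => t.reading.map Fin.castSucc ++ [Fin.last n]
  | n + 1, addSecond t => Fin.last n :: t.reading.map Fin.castSucc

theorem deg_le : ∀ {n} (t : TwoRowFilling n), t.deg ≤ n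
  | _, empty => le_rfl
  | _, addFirst t => t.deg_le.trans (Nat.le_succ _)
  | _, addSecond t => Nat.succ_le_succ t.deg_le

theorem IsBallot.two_mul_deg_le : ∀ {n} {t : TwoRowFilling n}, t.IsBallot → 2 * t.deg ≤ n
  | _, empty, _ => le_rfl
  | _, addFirst t, h => (IsBallot.two_mul_deg_le (t := t) h).trans (Nat.le_succ _)
  | _, addSecond _, h => h.2

theorem isEnum_reading {n : ℕ} (t : TwoRowFilling n) : IsEnum t.reading := by
  have hnotMem : ∀ {n} (l : List (Fin n)), Fin.last n ∉ l.map Fin.castSucc := fun l h => by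
    obtain ⟨p, -, hp⟩ := List.mem_map.1 h
    exact (Fin.castSucc_lt_last p).ne hp
  have hnodup : ∀ {n} {l : List (Fin n)}, IsEnum l → (l.map Fin.castSucc).Nodup := fun h =>
    h.1.map (Fin.castSucc_injective _)
  have hmem : ∀ {n} {l : List (Fin n)}, IsEnum l → ∀ p, Fin.castSucc p ∈ l.map Fin.castSucc :=
    fun h p => List.mem_map_of_mem (h.2 p)
  induction t with
  | empty => exact ⟨List.nodup_nil, fun p => p.elim0⟩
  | addFirst t ih =>
    refine ⟨?_, Fin.lastCases ?_ fun p => ?_⟩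
    · rw [reading, ← List.concat_eq_append]
      exact (hnodup ih).concat (hnotMem _)
    · exact List.mem_append_right _ (List.mem_singleton_self _)
    · exact List.mem_append_left _ (hmem ih p)
  | addSecond t ih =>
    refine ⟨List.nodup_cons.2 ⟨hnotMem _, hnodup ih⟩, Fin.lastCases ?_ fun p => ?_⟩
    · exact List.mem_cons_self
    · exact List.mem_cons_of_mem _ (hmem ih p)

theorem length_reading {n : ℕ} (t : TwoRowFilling n) : t.reading.length = n :=
  t.isEnum_reading.length_eq.trans (Fintype.card_fin n)

/-! Counting standard Young tableaux -/

/-- The standard Young tableaux of shape `(n - ℓ, ℓ)`. -/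
abbrev SYT (n ℓ : ℕ) : Type := {t : TwoRowFilling n // t.IsBallot ∧ t.deg = ℓ}

theorem natCard_SYT_succ {n ℓ : ℕ} (h : 2 * ℓ ≤ n + 1) :
    Nat.card (SYT (n + 1) ℓ) =
      Nat.card (SYT n ℓ) + Nat.card {t : TwoRowFilling n // t.IsBallot ∧ t.deg + 1 = ℓ} := by
  rw [← Nat.card_sum]
  refine Nat.card_congr (((succEquiv n).subtypeEquivOfSubtype'.trans Equiv.subtypeSum).trans
    (Equiv.sumCongr (Equiv.refl _) (Equiv.subtypeEquivRight fun t => ?_)))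
  change (t.IsBallot ∧ 2 * (t.deg + 1) ≤ n + 1) ∧ t.deg + 1 = ℓ ↔ _
  exact ⟨fun h => ⟨h.1.1, h.2⟩, fun h => ⟨⟨h.1, by omega⟩, h.2⟩⟩

theorem natCard_SYT (n : ℕ) : ∀ ℓ, 2 * ℓ ≤ n + 1 → (Nat.card (SYT n ℓ) : ℤ) = binomDiff n ℓ := by
  induction n with
  | zero =>
    intro ℓ hℓ
    obtain rfl : ℓ = 0 := by omega
    have : Unique (SYT 0 0) := { default := ⟨empty, trivial, rfl⟩, uniq := by rintro ⟨⟨⟩, -⟩; rfl }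
    rw [Nat.card_unique, binomDiff, Nat.choose_self]
  | succ n ih =>
    intro ℓ hℓ
    rcases (show 2 * ℓ ≤ n + 1 ∨ 2 * ℓ = n + 2 by omega) with hℓ | hℓ
    · rw [natCard_SYT_succ hℓ, Nat.cast_add, ih ℓ hℓ]
      rcases ℓ with - | ℓ
      · simp [binomDiff]
      · simp only [add_left_inj]
        rw [ih ℓ (by omega), binomDiff_succ_succ]
    · obtain ⟨ℓ, rfl⟩ : ∃ m, ℓ = m + 1 := ⟨ℓ - 1, by omega⟩
      obtain rfl : n = 2 * ℓ := by omega
      have : IsEmpty (SYT (2 * ℓ + 1) (ℓ + 1)) :=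
        ⟨fun t => by have := t.2.1.two_mul_deg_le; have := t.2.2; omega⟩
      rw [Nat.card_of_isEmpty, binomDiff, Nat.choose_symm_half, sub_self, Nat.cast_zero]

theorem natCard_SYT_pos {n ℓ : ℕ} (h : 2 * ℓ ≤ n) : 0 < Nat.card (SYT n ℓ) := by
  have hpos := binomDiff_pos h
  rwa [← natCard_SYT n ℓ (by omega), Nat.cast_pos] at hpos

/-! Words and their pairing with families of functions -/

section Word

variable {n : ℕ} {α : Type*}

/-- The word that is read off from a partially defined `α`-valued labelling `v` of the entries: the
labels in the order of `reading`. It is only defined if all entries of the second row have a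
label. -/
def word (t : TwoRowFilling n) (v : Fin n → Option α) : Option (List α) :=
  if ∀ p ∈ t.reading.take t.deg, (v p).isSome then some (t.reading.filterMap v) else none

theorem word_addFirst (t : TwoRowFilling n) (v : Fin (n + 1) → Option α) :
    t.addFirst.word v = (t.word (v ∘ Fin.castSucc)).map (· ++ (v (Fin.last n)).toList) := by
  have htake : t.addFirst.reading.take t.addFirst.deg =
      (t.reading.take t.deg).map Fin.castSucc := by
    have hlen : t.deg ≤ (t.reading.map Fin.castSucc).length := by
      rw [List.length_map, length_reading]
      exact t.deg_le
    rw [reading, deg, List.take_append_of_le_length hlen, List.map_take]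
  have hfilter : t.addFirst.reading.filterMap v =
      t.reading.filterMap (v ∘ Fin.castSucc) ++ (v (Fin.last n)).toList := by
    rw [reading, List.filterMap_append, List.filterMap_map, List.filterMap_cons]
    cases v (Fin.last n) <;> rfl
  simp only [word, htake, hfilter, List.forall_mem_map, Function.comp_apply,
    apply_ite (Option.map _), Option.map_some, Option.map_none]

theorem word_addSecond (t : TwoRowFilling n) (v : Fin (n + 1) → Option α) :
    t.addSecond.word v =
      (v (Fin.last n)).bind fun s => (t.word (v ∘ Fin.castSucc)).map (s :: ·) := by
  rcases hv : v (Fin.last n) with - | s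
  · simp [word, reading, deg, hv]
  · simp only [word, reading, deg, List.take_succ_cons, List.forall_mem_cons, hv,
      Option.isSome_some, true_and, ← List.map_take, List.forall_mem_map,
      List.filterMap_cons_some hv, List.filterMap_map, Function.comp_apply,
      apply_ite (Option.map _), Option.map_some, Option.map_none, Option.bind_some]

variable {B : Type*} [AddCommGroup B]

/-- The value at the labelling `v` of the function on labellings that is given by the functions
`y t` on words. -/
def pairing (y : TwoRowFilling n → List α → B) (v : Fin n → Option α) : B :=
  ∑ t : TwoRowFilling n, (t.word v).elim 0 (y t)

theorem pairing_succ (y : TwoRowFilling (n + 1) → List α → B) (v : Fin (n + 1) → Option α) :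
    pairing y v = pairing (fun t l => y t.addFirst (l ++ (v (Fin.last n)).toList) +
      (v (Fin.last n)).elim 0 fun s => y t.addSecond (s :: l)) (v ∘ Fin.castSucc) := by
  rw [pairing, sum_succ, ← Finset.sum_add_distrib, pairing]
  refine Finset.sum_congr rfl fun t _ => ?_
  rw [word_addFirst, word_addSecond]
  rcases t.word (v ∘ Fin.castSucc) with - | l <;> rcases v (Fin.last n) with - | s <;> simp

theorem pairing_snoc (y : TwoRowFilling (n + 1) → List α → B) (v : Fin n → Option α)
    (o : Option α) : pairing y (Fin.snoc (α := fun _ => Option α) v o) =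
      pairing (fun t l => y t.addFirst (l ++ o.toList) + o.elim 0 fun s => y t.addSecond (s :: l))
        v := by
  rw [pairing_succ, Fin.snoc_last]
  congr 1
  exact funext fun p => Fin.snoc_castSucc (α := fun _ => Option α) o v p

/-- The functions `y t` are concentrated on words of length `k`, and vanish unless `t` is a standard
Young tableau whose second row has length at most `k` and whose first row has length at least
`k`. -/
def IsSupported (k : ℕ) (y : TwoRowFilling n → List α → B) : Prop :=
  ∀ t l, y t l ≠ 0 → t.IsBallot ∧ t.deg ≤ k ∧ t.deg + k ≤ n ∧ l.length = k

variable (n α B) in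
/-- A supported family of functions on words is determined by the function on labellings that it
gives: the statement that is proved by induction on `n`. -/
def PairingNondegenerate : Prop :=
  ∀ (k : ℕ) (y : TwoRowFilling n → List α → B),
    IsSupported k y → (∀ v, pairing y v = 0) → ∀ t l, y t l = 0

variable {k : ℕ} {y : TwoRowFilling (n + 1) → List α → B}

theorem pairing_addFirst_eq_zero (h : ∀ v, pairing y v = 0) (v : Fin n → Option α) :
    pairing (fun t => y t.addFirst) v = 0 := by
  simpa using (pairing_snoc y v none).symm.trans (h _)

theorem pairing_add_addSecond_eq_zero (h : ∀ v, pairing y v = 0) (s : α) (v : Fin n → Option α) :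
    pairing (fun t l => y t.addFirst (l ++ [s]) + y t.addSecond (s :: l)) v = 0 := by
  simpa using (pairing_snoc y v (some s)).symm.trans (h _)

theorem eq_zero_of_two_mul_le (ih : PairingNondegenerate n α B) (hk : 2 * k ≤ n + 1)
    (hy : IsSupported k y) (h : ∀ v, pairing y v = 0) : ∀ t l, y t l = 0 := by
  have hfirst : ∀ t l, y (addFirst t) l = 0 := by
    refine ih k _ (fun t l ht => ?_) (pairing_addFirst_eq_zero h)
    obtain ⟨hb, hd, -, hl⟩ := hy _ l ht
    have := hb.two_mul_deg_le
    have : 2 * t.deg ≤ n := IsBallot.two_mul_deg_le (t := t) hb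
    simp only [deg] at hd
    exact ⟨hb, hd, by omega, hl⟩
  have hsecond : ∀ t l, y (addSecond t) l = 0 := by
    intro t l
    by_contra hne
    obtain ⟨-, hd, -, hl⟩ := hy _ _ hne
    obtain ⟨s, l, rfl⟩ := List.exists_cons_of_length_pos (hl.symm ▸ (Nat.succ_pos _).trans_le hd)
    refine hne (ih l.length (fun t l => y t.addSecond (s :: l)) (fun t l' ht => ?_)
      (fun v => ?_) t l)
    · obtain ⟨hb, hd, hn, hl'⟩ := hy _ _ ht
      simp only [deg, List.length_cons] at *
      exact ⟨hb.1, by omega, by omega, by omega⟩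
    · simpa only [hfirst, zero_add] using pairing_add_addSecond_eq_zero h s v
  rintro (t | t) l
  exacts [hfirst _ l, hsecond _ l]

theorem eq_zero_of_lt_two_mul (ih : PairingNondegenerate n α B) (hk : n + 1 < 2 * (k + 1))
    (hy : IsSupported (k + 1) y) (h : ∀ v, pairing y v = 0) : ∀ t l, y t l = 0 := by
  have hsum : ∀ s t l, y (addFirst t) (l ++ [s]) + y t.addSecond (s :: l) = 0 := by
    intro s
    refine ih k _ (fun t l ht => ?_) (pairing_add_addSecond_eq_zero h s)
    rcases ne_or_eq (y t.addFirst (l ++ [s])) 0 with hne | heq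
    · obtain ⟨hb, hd, hn, hl⟩ := hy _ _ hne
      have : 2 * t.deg ≤ n := IsBallot.two_mul_deg_le (t := t) hb
      simp only [deg, List.length_append, List.length_singleton] at *
      exact ⟨hb, by omega, by omega, by omega⟩
    · obtain ⟨hb, hd, hn, hl⟩ := hy _ _ (by rwa [heq, zero_add] at ht)
      simp only [deg, List.length_cons] at *
      exact ⟨hb.1, by omega, by omega, by omega⟩
  have hfirst : ∀ t l, y (addFirst t) l = 0 := by
    refine ih (k + 1) _ (fun t l ht => ?_) (pairing_addFirst_eq_zero h)
    obtain ⟨hb, hd, -, hl⟩ := hy _ _ ht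
    obtain ⟨l, s, rfl⟩ := (List.eq_nil_or_concat l).resolve_left (by rintro rfl; simp at hl)
    obtain ⟨-, -, hn, -⟩ := hy t.addSecond (s :: l) fun h0 => ht <| by
      simpa [h0] using hsum s t l
    simp only [deg] at *
    exact ⟨hb, hd, by omega, hl⟩
  rintro (t | t) l
  · exact hfirst _ l
  · by_contra hne
    obtain ⟨s, l, rfl⟩ := List.exists_cons_of_length_eq_add_one (hy _ _ hne).2.2.2
    exact hne (by simpa [hfirst] using hsum s _ l)

theorem pairingNondegenerate (n : ℕ) : PairingNondegenerate n α B := by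
  induction n with
  | zero =>
    intro k y hy h t l
    obtain rfl := Unique.eq_default t
    by_contra hne
    obtain ⟨-, -, hk, hl⟩ := hy _ _ hne
    obtain rfl : l = [] := List.length_eq_zero_iff.1 (by omega)
    have h0 : pairing y Fin.elim0 = y default [] := Fintype.sum_unique _
    exact hne (h0.symm.trans (h _))
  | succ n ih =>
    intro k y hy h
    rcases le_or_gt (2 * k) (n + 1) with hk | hk
    · exact eq_zero_of_two_mul_le ih hk hy h
    · obtain ⟨k, rfl⟩ : ∃ m, k = m + 1 := ⟨k - 1, by omega⟩
      exact eq_zero_of_lt_two_mul ih hk hy h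

end Word

end TwoRowFilling

/-! Representable modules in low degrees -/

/-- The natural map from the representable module `ℤ FI(-, T)` to `N` that belongs to an element
`w` of degree `T`. -/
def FI.yonedaMap (N : FIᵒᵖ ⥤ ModuleCat.{0} ℤ) {T : FI} (w : N.obj (Opposite.op T)) (S : FI) :
    ((S ⟶ T) →₀ ℤ) →ₗ[ℤ] N.obj (Opposite.op S) :=
  Finsupp.linearCombination ℤ fun f => (N.map f.op).hom w

theorem FI.yonedaMap_single (N : FIᵒᵖ ⥤ ModuleCat.{0} ℤ) {S T : FI} (w : N.obj (Opposite.op T))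
    (f : S ⟶ T) : FI.yonedaMap N w S (Finsupp.single f 1) = (N.map f.op).hom w :=
  (Finsupp.linearCombination_single ℤ 1 f).trans ((N.obj (.op S)).isModule.one_smul _)

theorem FI.yonedaMap_precomp (N : FIᵒᵖ ⥤ ModuleCat.{0} ℤ) {S S' T : FI}
    (w : N.obj (Opposite.op T)) (h : S ⟶ S') (x : (S' ⟶ T) →₀ ℤ) :
    FI.yonedaMap N w S (Finsupp.lmapDomain ℤ ℤ (h ≫ ·) x) =
      (N.map h.op).hom (FI.yonedaMap N w S' x) := by
  induction x using Finsupp.induction_linear with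
  | zero => simp
  | add x y hx hy => simp only [map_add, hx, hy]
  | single f c => simp [FI.yonedaMap]

/-- `EmbSpace.basis`, as a basis of a value of the functor `Xi ℓ`. -/
def Xi.basis (ℓ : ℕ) (S : FI) :
    Module.Basis (EmbSpace.LongEnum ℓ S) ℤ ((Xi ℓ).obj (Opposite.op S)) :=
  EmbSpace.basis ℓ S

instance (k : ℕ) : Finite (FI.std k).carrier := inferInstanceAs (Finite (Fin k))

instance (k n : ℕ) : Finite (FI.std k ⟶ FI.std n) := inferInstanceAs (Finite (Fin k ↪ Fin n))

instance (ℓ k : ℕ) : Module.Free ℤ ((Xi ℓ).obj (Opposite.op (FI.std k))) :=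
  .of_basis (Xi.basis ℓ (FI.std k))

instance (ℓ k : ℕ) : Finite (EmbSpace.LongEnum ℓ (FI.std k)) :=
  Finite.of_injective (fun l => (⟨l.1, l.2.1.1⟩ : {l : List (Fin k) // l.Nodup}))
    fun _ _ h => Subtype.ext (Subtype.mk.inj h)

instance (ℓ k : ℕ) : Module.Finite ℤ ((Xi ℓ).obj (Opposite.op (FI.std k))) :=
  .of_basis (Xi.basis ℓ (FI.std k))

theorem surjective_pi_of_forall_eq_zero {A P : Type*} {ι : Type u} {G : ι → Type v} [Ring A]
    [Fintype ι] [AddCommGroup P] [Module A P] [∀ i, AddCommGroup (G i)] [∀ i, Module A (G i)]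
    (φ : ∀ i, P →ₗ[A] G i)
    (h : ∀ {B : Type (max u v)} [AddCommGroup B] [Module A B] (E : ∀ i, G i →ₗ[A] B),
      (∀ x, ∑ i, E i (φ i x) = 0) → ∀ i, E i = 0) : Function.Surjective (LinearMap.pi φ) := by
  classical
  let q := (LinearMap.range (LinearMap.pi φ)).mkQ
  have hqφ : ∀ x, ∑ i, (q ∘ₗ LinearMap.single A G i) (φ i x) = 0 := fun x => by
    simp only [LinearMap.comp_apply, LinearMap.coe_single]
    rw [← map_sum, Finset.univ_sum_single]
    exact (Submodule.Quotient.mk_eq_zero _).2 (LinearMap.mem_range_self (LinearMap.pi φ) x)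
  have hq : q = 0 := LinearMap.pi_ext' fun i => (h _ hqφ i).trans (LinearMap.zero_comp _).symm
  rw [← LinearMap.range_eq_top, ← Submodule.ker_mkQ (LinearMap.range (LinearMap.pi φ))]
  exact LinearMap.ker_eq_top.2 hq

instance (n ℓ : ℕ) : Fintype (TwoRowFilling.SYT n ℓ) := Fintype.ofFinite _

/-- The standard Young tableaux with `n` entries and at most two rows, the second one of length at
most `d`. -/
abbrev Tableau (n d : ℕ) : Type := Σ ℓ : Fin (d + 1), TwoRowFilling.SYT n ℓ

namespace Tableau

variable {n d k : ℕ}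

/-- The underlying filling. -/
abbrev toFilling (σ : Tableau n d) : TwoRowFilling n := σ.2.1

theorem injective_toFilling : Function.Injective (toFilling (n := n) (d := d)) := by
  rintro ⟨ℓ, t, ht⟩ ⟨ℓ', t', ht'⟩ (rfl : t = t')
  obtain rfl : ℓ = ℓ' := Fin.ext (ht.2.symm.trans ht'.2)
  rfl

theorem isBallot (σ : Tableau n d) : σ.toFilling.IsBallot := σ.2.2.1

theorem deg_toFilling (σ : Tableau n d) : σ.toFilling.deg = σ.1 := σ.2.2.2

/-- The class of the embedding of the entries that is given by the reading of a tableau. -/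
def xi (σ : Tableau n d) : (Xi σ.1).obj (Opposite.op (FI.std n)) :=
  EmbSpace.cls (EmbSpace.ofEnum σ.1 σ.toFilling.reading σ.toFilling.isEnum_reading)

open Classical in
/-- The class of the embeddings with word `l`, or `0` if `l` is not the word of an embedding that
contains `[ℓ]` in its image. -/
def wordClass (σ : Tableau n d) (l : List (Fin k)) : (Xi σ.1).obj (Opposite.op (FI.std k)) :=
  if h : IsEnum l ∧ σ.1 ≤ l.length then Xi.basis σ.1 (FI.std k) ⟨l, h⟩ else 0

theorem wordClass_eq_basis (σ : Tableau n d) {l : List (Fin k)} (h : IsEnum l ∧ σ.1 ≤ l.length) :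
    σ.wordClass l = Xi.basis σ.1 (FI.std k) ⟨l, h⟩ :=
  dif_pos h

theorem isEnum_of_wordClass_ne_zero {σ : Tableau n d} {l : List (Fin k)} (h : σ.wordClass l ≠ 0) :
    IsEnum l ∧ σ.1 ≤ l.length :=
  not_imp_comm.1 (fun h' => dif_neg h') h

theorem Xi_map_xi (σ : Tableau n d) (f : FI.std k ⟶ FI.std n) :
    ((Xi σ.1).map f.op).hom σ.xi =
      (σ.toFilling.word (Function.partialInv (FI.toFun f))).elim 0 σ.wordClass := by
  have hℓ : (σ.1 : ℕ) ≤ σ.toFilling.reading.length := by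
    rw [TwoRowFilling.length_reading, ← σ.deg_toFilling]
    exact σ.toFilling.deg_le
  have hmap : ((Xi σ.1).map f.op).hom σ.xi = EmbSpace.cls (EmbSpace.precomp σ.1 f
      (EmbSpace.ofEnum σ.1 σ.toFilling.reading σ.toFilling.isEnum_reading)) :=
    RelH0.map_mk_single _ (EmbSpace.continuous_precomp _ f) (EmbSpace.mapsTo_precomp _ f) _
  have hbad := EmbSpace.precomp_ofEnum_notMem_bad_iff σ.toFilling.isEnum_reading hℓ f
  rw [hmap, TwoRowFilling.word, σ.deg_toFilling]
  split_ifs with h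
  · have hw := (EmbSpace.isWord_ofEnum σ.toFilling.isEnum_reading σ.1).precomp f
    exact (EmbSpace.cls_eq_basis hw (hbad.2 h)).trans
      (σ.wordClass_eq_basis ⟨hw.isEnum, hw.le_length (hbad.2 h)⟩).symm
  · exact EmbSpace.cls_eq_zero (not_not.1 fun h' => h (hbad.1 h'))

theorem isSupported_extend {B : Type*} [AddCommGroup B] (hn : 2 * d ≤ n + 1) (hk : k ≤ d)
    {y : Tableau n d → List (Fin k) → B} (hy : ∀ σ l, y σ l ≠ 0 → IsEnum l ∧ σ.1 ≤ l.length) :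
    TwoRowFilling.IsSupported k (Function.extend toFilling y 0) := by
  intro t l htl
  by_cases ht : ∃ σ : Tableau n d, σ.toFilling = t
  · obtain ⟨σ, rfl⟩ := ht
    rw [injective_toFilling.extend_apply] at htl
    obtain ⟨hl, hσ⟩ := hy σ l htl
    have hlen : l.length = k := hl.length_eq.trans (Fintype.card_fin k)
    have hb := σ.isBallot.two_mul_deg_le
    have hdeg := σ.deg_toFilling
    exact ⟨σ.isBallot, by omega, by omega, hlen⟩
  · rw [Function.extend_apply' _ _ _ ht] at htl
    exact absurd rfl htl

theorem pairing_extend {B : Type*} [AddCommGroup B] (y : Tableau n d → List (Fin k) → B)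
    (v : Fin n → Option (Fin k)) :
    TwoRowFilling.pairing (Function.extend toFilling y 0) v =
      ∑ σ : Tableau n d, (σ.toFilling.word v).elim 0 (y σ) := by
  refine (Fintype.sum_of_injective toFilling injective_toFilling _ _ (fun t ht => ?_)
    fun σ => ?_).symm
  · rw [Function.extend_apply' _ _ _ ht]
    cases t.word v <;> rfl
  · rw [injective_toFilling.extend_apply]

theorem eq_zero_of_sum_Xi_map_xi {B : Type*} [AddCommGroup B] [Module ℤ B]
    (hn : 2 * d ≤ n + 1) (hk : k ≤ d)
    (E : ∀ σ : Tableau n d, (Xi σ.1).obj (Opposite.op (FI.std k)) →ₗ[ℤ] B)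
    (hE : ∀ f : FI.std k ⟶ FI.std n, ∑ σ, E σ (((Xi σ.1).map f.op).hom σ.xi) = 0)
    (σ : Tableau n d) : E σ = 0 := by
  let y : Tableau n d → List (Fin k) → B := fun σ l => E σ (σ.wordClass l)
  have hy : ∀ σ l, y σ l ≠ 0 → IsEnum l ∧ σ.1 ≤ l.length := fun σ l h =>
    isEnum_of_wordClass_ne_zero fun h0 => h ((congrArg (E σ) h0).trans (map_zero _))
  have hpairing : ∀ v, ∑ σ : Tableau n d, (σ.toFilling.word v).elim 0 (y σ) = 0 := by
    intro v
    by_cases hv : ∃ f : Fin k → Fin n, f.Injective ∧ Function.partialInv f = v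
    · obtain ⟨f, hf, rfl⟩ := hv
      let f' : FI.std k ⟶ FI.std n := (⟨f, hf⟩ : Fin k ↪ Fin n)
      refine (Finset.sum_congr rfl fun σ _ => ?_).trans (hE f')
      rw [Xi_map_xi]
      change Option.elim (σ.toFilling.word (Function.partialInv f)) 0 (y σ) =
        E σ (Option.elim (σ.toFilling.word (Function.partialInv f)) 0 σ.wordClass)
      cases σ.toFilling.word (Function.partialInv f)
      exacts [(map_zero _).symm, rfl]
    · refine Finset.sum_eq_zero fun σ _ => ?_
      rcases hl : σ.toFilling.word v with - | l
      · rfl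
      · by_contra h0
        obtain rfl := Option.some.inj (Option.ite_none_right_eq_some.1 hl).2
        exact hv (σ.toFilling.isEnum_reading.exists_partialInv_eq (hy _ _ h0).1)
  refine (Xi.basis σ.1 (FI.std k)).ext fun l => ?_
  have hzero : y σ l.1 = 0 := by
    rw [← injective_toFilling.extend_apply y 0 σ]
    exact TwoRowFilling.pairingNondegenerate n k _ (isSupported_extend hn hk hy)
      (fun v => (pairing_extend y v).trans (hpairing v)) _ _
  exact (congrArg (E σ) (σ.wordClass_eq_basis l.2).symm).trans hzero

theorem surjective_yonedaMap_xi (hn : 2 * d ≤ n + 1) (hk : k ≤ d) : Function.Surjective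
    (LinearMap.pi fun σ : Tableau n d => FI.yonedaMap (Xi σ.1) σ.xi (FI.std k)) := by
  refine surjective_pi_of_forall_eq_zero _ fun E hE => eq_zero_of_sum_Xi_map_xi hn hk E fun f => ?_
  simpa only [FI.yonedaMap_single] using hE (Finsupp.single f 1)

theorem sum_finrank_Xi (hn : 2 * d ≤ n + 1) (hk : k ≤ d) :
    ∑ σ : Tableau n d, Module.finrank ℤ ((Xi σ.1).obj (Opposite.op (FI.std k))) =
      k.factorial * n.choose k := by
  have hrank : ∀ ℓ : ℕ, Module.finrank ℤ ((Xi ℓ).obj (Opposite.op (FI.std k))) =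
    if ℓ ≤ k then k.factorial else 0 := fun ℓ => EmbSpace.finrank_relH0_std ℓ k
  have hsum : ∑ ℓ ∈ Finset.range (d + 1),
      Nat.card (TwoRowFilling.SYT n ℓ) * (if ℓ ≤ k then k.factorial else 0) =
      ∑ ℓ ∈ Finset.range (k + 1), Nat.card (TwoRowFilling.SYT n ℓ) * k.factorial := by
    simp only [mul_ite, mul_zero, ← Finset.sum_filter]
    congr 1
    grind
  have hcount : ∑ ℓ ∈ Finset.range (k + 1), Nat.card (TwoRowFilling.SYT n ℓ) = n.choose k := by
    zify
    rw [← sum_binomDiff]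
    refine Finset.sum_congr rfl fun ℓ hℓ => TwoRowFilling.natCard_SYT n ℓ ?_
    have := Finset.mem_range.1 hℓ
    omega
  rw [mul_comm, ← hcount, Finset.sum_mul, ← hsum, ← Fin.sum_univ_eq_sum_range, Fintype.sum_sigma]
  simp only [hrank, Finset.sum_const, Finset.card_univ, Nat.card_eq_fintype_card, smul_eq_mul]

theorem bijective_yonedaMap_xi (hn : 2 * d ≤ n + 1) (hk : k ≤ d) : Function.Bijective
    (LinearMap.pi fun σ : Tableau n d => FI.yonedaMap (Xi σ.1) σ.xi (FI.std k)) := by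
  have hrank : Module.finrank ℤ ((FI.std k ⟶ FI.std n) →₀ ℤ) = k.factorial * n.choose k := by
    rw [Module.finrank_eq_nat_card_basis Finsupp.basisSingleOne,
      ← Nat.descFactorial_eq_factorial_mul_choose]
    exact (Nat.card_eq_fintype_card (α := Fin k ↪ Fin n)).trans (by simp)
  refine OrzechProperty.bijective_of_surjective_of_finrank_le _ (surjective_yonedaMap_xi hn hk) ?_
  rw [hrank, Module.finrank_pi_fintype, sum_finrank_Xi hn hk]

end Tableau

/-! Modules presented in low degrees, and tensor products -/

section Tensor

variable {R : Type u} [CommRing R] {M : FI ⥤ ModuleCat.{v} R}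

/-- The action of formal linear combinations of injections. -/
def FI.act (M : FI ⥤ ModuleCat.{v} R) (S T : FI) :
    ((S ⟶ T) →₀ ℤ) →ₗ[ℤ] (M.obj S →ₗ[R] M.obj T) :=
  Finsupp.linearCombination ℤ fun f => (M.map f).hom

theorem FI.act_single (M : FI ⥤ ModuleCat.{v} R) {S T : FI} (f : S ⟶ T) :
    FI.act M S T (Finsupp.single f 1) = (M.map f).hom := by
  simp [FI.act]

theorem FI.act_precomp (M : FI ⥤ ModuleCat.{v} R) {S S' T : FI} (h : S ⟶ S')
    (x : (S' ⟶ T) →₀ ℤ) (m : M.obj S) :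
    FI.act M S T (Finsupp.lmapDomain ℤ ℤ (h ≫ ·) x) m = FI.act M S' T x ((M.map h).hom m) := by
  induction x using Finsupp.induction_linear with
  | zero => simp
  | add x y hx hy => simp only [map_add, LinearMap.add_apply, hx, hy]
  | single f c =>
    simp [FI.act]

theorem FreeFI.desc_single (M : FI ⥤ ModuleCat.{v} R) {I : Type v} (a : I → ℕ)
    (g : ∀ i, M.obj (FI.std (a i))) {S : FI} (i : I) (f : FI.std (a i) ⟶ S) :
    FreeFI.desc M a g S (Finsupp.single ⟨i, f⟩ 1) = (M.map f).hom (g i) := by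
  simp [FreeFI.desc]

theorem FreeFI.map_single {I : Type v} (a : I → ℕ) {S T : FI} (h : S ⟶ T) (i : I)
    (f : FI.std (a i) ⟶ S) :
    FreeFI.map R a h (Finsupp.single ⟨i, f⟩ 1) = Finsupp.single ⟨i, f ≫ h⟩ 1 := by
  simp [FreeFI.map]

theorem FreeFI.map_id {I : Type v} (a : I → ℕ) {S : FI} (y : FreeFI R a S) :
    FreeFI.map R a (𝟙 S) y = y := by
  simp only [FreeFI.map, Category.comp_id]
  exact Finsupp.mapDomain_id

theorem FreeFI.hom_ext {I : Type v} {a : I → ℕ} {S : FI} {P : Type*} [AddCommMonoid P] [Module R P]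
    {F G : FreeFI R a S →ₗ[R] P}
    (h : ∀ i f, F (Finsupp.single ⟨i, f⟩ 1) = G (Finsupp.single ⟨i, f⟩ 1)) : F = G :=
  Finsupp.lhom_ext' fun p => LinearMap.ext_ring (h p.1 p.2)

theorem FreeFI.desc_map (M : FI ⥤ ModuleCat.{v} R) {I : Type v} (a : I → ℕ)
    (g : ∀ i, M.obj (FI.std (a i))) {S T : FI} (h : S ⟶ T) (y : FreeFI R a S) :
    FreeFI.desc M a g T (FreeFI.map R a h y) = (M.map h).hom (FreeFI.desc M a g S y) := by
  suffices FreeFI.desc M a g T ∘ₗ FreeFI.map R a h = (M.map h).hom ∘ₗ FreeFI.desc M a g S from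
    LinearMap.congr_fun this y
  refine FreeFI.hom_ext fun i f => ?_
  rw [LinearMap.comp_apply, LinearMap.comp_apply, FreeFI.map_single, FreeFI.desc_single,
    FreeFI.desc_single]
  simp

namespace IsPresentedInDegreesLE

variable {d : ℕ} {S : FI}

theorem hom_ext (hM : IsPresentedInDegreesLE M d) {P : Type*} [AddCommMonoid P] [Module R P]
    {F G : M.obj S →ₗ[R] P}
    (h : ∀ k ≤ d, ∀ (f : FI.std k ⟶ S) m, F ((M.map f).hom m) = G ((M.map f).hom m)) : F = G := by
  obtain ⟨I, a, g, -, -, -, ha, -, hsurj, -⟩ := hM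
  refine (LinearMap.cancel_right (hsurj S)).1 (FreeFI.hom_ext fun i f => ?_)
  simp only [LinearMap.comp_apply, FreeFI.desc_single, h _ (ha i)]

theorem exists_desc (hM : IsPresentedInDegreesLE M d) {P : Type*} [AddCommGroup P] [Module R P]
    (φ : ∀ k, (FI.std k ⟶ S) → (M.obj (FI.std k) →ₗ[R] P))
    (hφ : ∀ p ≤ d, ∀ q ≤ d, ∀ (h : FI.std p ⟶ FI.std q) (f : FI.std q ⟶ S) m,
      φ q f ((M.map h).hom m) = φ p (h ≫ f) m) :
    ∃ F : M.obj S →ₗ[R] P, ∀ k ≤ d, ∀ f m, F ((M.map f).hom m) = φ k f m := by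
  obtain ⟨I, a, g, J, b, r, ha, hb, hsurj, hker⟩ := hM
  let D : FreeFI R a S →ₗ[R] P := Finsupp.linearCombination R fun p => φ (a p.1) p.2 (g p.1)
  have hD : ∀ k ≤ d, ∀ (f : FI.std k ⟶ S) (y : FreeFI R a (FI.std k)),
      D (FreeFI.map R a f y) = φ k f (FreeFI.desc M a g _ y) := fun k hk f y => by
    suffices D ∘ₗ FreeFI.map R a f = φ k f ∘ₗ FreeFI.desc M a g _ from LinearMap.congr_fun this y
    refine FreeFI.hom_ext fun i h => ?_
    simp only [LinearMap.comp_apply, FreeFI.map_single, FreeFI.desc_single, hφ _ (ha i) k hk, D,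
      Finsupp.linearCombination_single, one_smul]
  have hrel : ∀ j, FreeFI.desc M a g _ (r j) = 0 := fun j => by
    rw [← LinearMap.mem_ker, hker]
    exact Submodule.subset_span ⟨j, 𝟙 _, (FreeFI.map_id _ _).symm⟩
  have hle : LinearMap.ker (FreeFI.desc M a g S) ≤ LinearMap.ker D := by
    rw [hker, Submodule.span_le]
    rintro _ ⟨j, f, rfl⟩
    rw [SetLike.mem_coe, LinearMap.mem_ker, hD _ (hb j), hrel, map_zero]
  let e := (FreeFI.desc M a g S).quotKerEquivOfSurjective (hsurj S)
  refine ⟨Submodule.liftQ _ D hle ∘ₗ e.symm.toLinearMap, fun k hk f m => ?_⟩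
  obtain ⟨y, rfl⟩ := hsurj _ m
  rw [← hD k hk, ← FreeFI.desc_map]
  exact congrArg (Submodule.liftQ _ D hle) (e.symm_apply_apply (Submodule.Quotient.mk _))

end IsPresentedInDegreesLE

variable {N : FIᵒᵖ ⥤ ModuleCat.{0} ℤ}

namespace TensorSum

theorem add_tmul (k : ℕ) (m m' : M.obj (FI.std k)) (ξ : N.obj (Opposite.op (FI.std k))) :
    tmul M N k (m + m') ξ = tmul M N k m ξ + tmul M N k m' ξ := by
  rw [tmul, TensorProduct.add_tmul, map_add]
  rfl

theorem tmul_add (k : ℕ) (m : M.obj (FI.std k)) (ξ ξ' : N.obj (Opposite.op (FI.std k))) :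
    tmul M N k m (ξ + ξ') = tmul M N k m ξ + tmul M N k m ξ' := by
  rw [tmul, TensorProduct.tmul_add, map_add]
  rfl

theorem smul_tmul (k : ℕ) (c : R) (m : M.obj (FI.std k)) (ξ : N.obj (Opposite.op (FI.std k))) :
    tmul M N k (c • m) ξ = c • tmul M N k m ξ := by
  rw [tmul, ← TensorProduct.smul_tmul', map_smul]
  rfl

end TensorSum

namespace TensorFI

variable (M N) in
/-- The class of `m ⊗ ξ`, as a bilinear map. -/
def mk (k : ℕ) : M.obj (FI.std k) →ₗ[R] N.obj (Opposite.op (FI.std k)) →ₗ[ℤ] TensorFI M N :=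
  LinearMap.mk₂' R ℤ (fun m ξ => Submodule.Quotient.mk (TensorSum.tmul M N k m ξ))
    (fun m m' ξ => congrArg Submodule.Quotient.mk (TensorSum.add_tmul k m m' ξ))
    (fun c m ξ => congrArg Submodule.Quotient.mk (TensorSum.smul_tmul k c m ξ))
    (fun m ξ ξ' => congrArg Submodule.Quotient.mk (TensorSum.tmul_add k m ξ ξ'))
    (fun c m ξ => map_intCast_smul (AddMonoidHom.mk' (fun ξ => (Submodule.Quotient.mk
      (TensorSum.tmul M N k m ξ) : TensorFI M N))
      fun ξ ξ' => congrArg Submodule.Quotient.mk (TensorSum.tmul_add k m ξ ξ')) ℤ ℤ c ξ)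

theorem mk_map {p q : ℕ} (f : FI.std p ⟶ FI.std q) (m : M.obj (FI.std p))
    (ξ : N.obj (Opposite.op (FI.std q))) :
    mk M N q ((M.map f).hom m) ξ = mk M N p m ((N.map f.op).hom ξ) :=
  (Submodule.Quotient.eq _).2 (Submodule.subset_span ⟨p, q, f, m, ξ, rfl⟩)

theorem exists_lift {P : Type*} [AddCommGroup P] [Module R P]
    (B : ∀ k, M.obj (FI.std k) →ₗ[R] N.obj (Opposite.op (FI.std k)) →ₗ[ℤ] P)
    (hB : ∀ (p q : ℕ) (f : FI.std p ⟶ FI.std q) (m : M.obj (FI.std p))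
      (ξ : N.obj (Opposite.op (FI.std q))), B q ((M.map f).hom m) ξ = B p m ((N.map f.op).hom ξ)) :
    ∃ θ : TensorFI M N →ₗ[R] P, ∀ k m ξ, θ (mk M N k m ξ) = B k m ξ := by
  let θ₀ : TensorSum M N →ₗ[R] P :=
    DirectSum.toModule R ℕ P fun k => TensorProduct.AlgebraTensorModule.lift (B k)
  have hθ₀ : ∀ k m ξ, θ₀ (TensorSum.tmul M N k m ξ) = B k m ξ := fun k m ξ => by
    simp [θ₀, TensorSum.tmul]
  refine ⟨Submodule.liftQ _ θ₀ ?_, hθ₀⟩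
  rw [Submodule.span_le]
  rintro _ ⟨p, q, f, m, ξ, rfl⟩
  rw [SetLike.mem_coe, LinearMap.mem_ker, map_sub, hθ₀, hθ₀, hB, sub_self]

theorem hom_ext {P : Type*} [AddCommMonoid P] [Module R P] {θ θ' : TensorFI M N →ₗ[R] P}
    (h : ∀ k m ξ, θ (mk M N k m ξ) = θ' (mk M N k m ξ)) : θ = θ' := by
  let := Module.addCommMonoidToAddCommGroup R (M := P)
  refine (LinearMap.cancel_right (Submodule.mkQ_surjective _)).1 (DirectSum.linearMap_ext R fun k =>
    TensorProduct.AlgebraTensorModule.ext fun m ξ => ?_)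
  exact h k m ξ

theorem exists_lift_of_le {d : ℕ} (hM : IsPresentedInDegreesLE M d) {P : Type*} [AddCommGroup P]
    [Module R P] (B : ∀ k, M.obj (FI.std k) →ₗ[R] N.obj (Opposite.op (FI.std k)) →ₗ[ℤ] P)
    (hB : ∀ p ≤ d, ∀ q ≤ d, ∀ (f : FI.std p ⟶ FI.std q) (m : M.obj (FI.std p))
      (ξ : N.obj (Opposite.op (FI.std q))), B q ((M.map f).hom m) ξ = B p m ((N.map f.op).hom ξ)) :
    ∃ θ : TensorFI M N →ₗ[R] P, ∀ k ≤ d, ∀ m ξ, θ (mk M N k m ξ) = B k m ξ := by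
  have hext : ∀ n, ∃ B' : M.obj (FI.std n) →ₗ[R] N.obj (Opposite.op (FI.std n)) →ₗ[ℤ] P,
      ∀ k ≤ d, ∀ f m, B' ((M.map f).hom m) = B k m ∘ₗ (N.map f.op).hom := fun n => by
    refine hM.exists_desc (fun k f => (B k).compl₂ (N.map f.op).hom) fun p hp q hq h f m => ?_
    ext ξ
    simp [hB p hp q hq]
  choose B' hB' using hext
  obtain ⟨θ, hθ⟩ := exists_lift B' fun p q f m ξ => by
    suffices (B' q).flip ξ ∘ₗ (M.map f).hom = (B' p).flip ((N.map f.op).hom ξ) from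
      LinearMap.congr_fun this m
    refine hM.hom_ext fun k hk g m => ?_
    have hcomp : (M.map f).hom ((M.map g).hom m) = (M.map (g ≫ f)).hom m := by simp
    rw [LinearMap.comp_apply, LinearMap.flip_apply, LinearMap.flip_apply, hcomp, hB' q k hk,
      hB' p k hk]
    simp
  refine ⟨θ, fun k hk m ξ => ?_⟩
  have hid := LinearMap.congr_fun (hB' k k hk (𝟙 _) m) ξ
  simp only [CategoryTheory.Functor.map_id, op_id, ModuleCat.hom_id, LinearMap.id_apply,
    LinearMap.comp_id] at hid
  rw [hθ, hid]

theorem hom_ext_of_le {d : ℕ} (hM : IsPresentedInDegreesLE M d) {P : Type*} [AddCommMonoid P]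
    [Module R P] {θ θ' : TensorFI M N →ₗ[R] P}
    (h : ∀ k ≤ d, ∀ m ξ, θ (mk M N k m ξ) = θ' (mk M N k m ξ)) : θ = θ' := by
  refine hom_ext fun n m ξ => ?_
  suffices θ ∘ₗ (mk M N n).flip ξ = θ' ∘ₗ (mk M N n).flip ξ from LinearMap.congr_fun this m
  refine hM.hom_ext fun k hk f m => ?_
  simp only [LinearMap.comp_apply, LinearMap.flip_apply, mk_map, h k hk]

end TensorFI

variable {ι : Type*} (N : ι → FIᵒᵖ ⥤ ModuleCat.{0} ℤ) {n : ℕ}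
  (w : ∀ t, (N t).obj (Opposite.op (FI.std n)))

variable (M) in
/-- The natural map `m ↦ (m ⊗ w t)` from `M_n` to a product of tensor products. -/
def toTensorPi : M.obj (FI.std n) →ₗ[R] ∀ t, TensorFI M (N t) :=
  LinearMap.pi fun t => (TensorFI.mk M (N t) n).flip (w t)

theorem toTensorPi_act {k : ℕ} (x : (FI.std k ⟶ FI.std n) →₀ ℤ) (m : M.obj (FI.std k)) (t : ι) :
    toTensorPi M N w (FI.act M _ _ x m) t =
      TensorFI.mk M (N t) k m (FI.yonedaMap (N t) (w t) _ x) := by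
  induction x using Finsupp.induction_linear with
  | zero => simp
  | add x y hx hy => simp only [map_add, LinearMap.add_apply, Pi.add_apply, hx, hy]
  | single f c => simp [FI.yonedaMap, FI.act, toTensorPi, TensorFI.mk_map]

variable {N w} {d : ℕ}

theorem TensorFI.exists_lift_act [DecidableEq ι] (hM : IsPresentedInDegreesLE M d)
    (hN : ∀ k ≤ d, Function.Bijective
      (LinearMap.pi fun t => FI.yonedaMap (N t) (w t) (FI.std k))) (t : ι) :
    ∃ θ : TensorFI M (N t) →ₗ[R] M.obj (FI.std n), ∀ k ≤ d, ∀ m ξ x,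
      (∀ s, FI.yonedaMap (N s) (w s) _ x = Pi.single (M := fun s => (N s).obj _) t ξ s) →
        θ (TensorFI.mk M (N t) k m ξ) = FI.act M _ _ x m := by
  have hB : ∀ k, ∃ B : M.obj (FI.std k) →ₗ[R] (N t).obj (Opposite.op (FI.std k)) →ₗ[ℤ]
      M.obj (FI.std n), k ≤ d → ∀ m ξ x, (∀ s, FI.yonedaMap (N s) (w s) _ x =
        Pi.single (M := fun s => (N s).obj _) t ξ s) → B m ξ = FI.act M _ _ x m := fun k => by
    by_cases hk : k ≤ d
    · let e := AddEquiv.ofBijective _ (hN k hk)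
      let g := (FI.act M (FI.std k) (FI.std n)).toAddMonoidHom.comp
        (e.symm.toAddMonoidHom.comp (AddMonoidHom.single _ t))
      refine ⟨LinearMap.flip { g with map_smul' := map_intCast_smul g ℤ ℤ }, fun _ m ξ x hx => ?_⟩
      rw [← e.symm_apply_apply x]
      exact congrArg (fun z => FI.act M _ _ (e.symm z) m) (funext hx).symm
    · exact ⟨0, fun h => absurd h hk⟩
  choose B hB using hB
  obtain ⟨θ, hθ⟩ := TensorFI.exists_lift_of_le hM B fun p hp q hq f m ξ => by
    obtain ⟨x, hx⟩ := (hN q hq).2 (Pi.single t ξ)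
    have hx' : ∀ s, FI.yonedaMap (N s) (w s) _ (Finsupp.lmapDomain ℤ ℤ (f ≫ ·) x) =
        Pi.single (M := fun s => (N s).obj _) t (((N t).map f.op).hom ξ) s := fun s => by
      rw [FI.yonedaMap_precomp]
      exact (congrArg _ (congrFun hx s)).trans
        (Pi.apply_single (fun s => ((N s).map f.op).hom) (fun _ => map_zero _) t ξ s)
    rw [hB q hq _ ξ x (congrFun hx), hB p hp _ _ _ hx', FI.act_precomp]
  exact ⟨θ, fun k hk m ξ x hx => (hθ k hk m ξ).trans (hB k hk m ξ x hx)⟩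

/-- By the co-Yoneda lemma `M ⊗_FI ℤ FI(-, [n]) = M_n`, and for `M` presented in degrees `≤ d` the
tensor product only depends on the other factor in degrees `≤ d`. -/
theorem bijective_toTensorPi [Finite ι] (hM : IsPresentedInDegreesLE M d)
    (hN : ∀ k ≤ d, Function.Bijective
      (LinearMap.pi fun t => FI.yonedaMap (N t) (w t) (FI.std k))) :
    Function.Bijective (toTensorPi M N w) := by
  classical
  cases nonempty_fintype ι
  choose θ hθ using TensorFI.exists_lift_act hM hN
  have hright : ∀ t, toTensorPi M N w ∘ₗ θ t =
      LinearMap.single R (fun t => TensorFI M (N t)) t := by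
    refine fun t => TensorFI.hom_ext_of_le hM fun k hk m ξ => ?_
    obtain ⟨x, hx⟩ := (hN k hk).2 (Pi.single t ξ)
    refine funext fun s => ?_
    rw [LinearMap.comp_apply, hθ t k hk m ξ x (congrFun hx), toTensorPi_act]
    exact (congrArg _ (congrFun hx s)).trans
      (Pi.apply_single (fun s => TensorFI.mk M (N s) k m) (fun _ => map_zero _) t ξ s)
  have hleft : ∑ t, θ t ∘ₗ LinearMap.proj t ∘ₗ toTensorPi M N w = LinearMap.id := by
    refine hM.hom_ext fun k hk f m => ?_
    choose x hx using fun t => (hN k hk).2 (Pi.single t (((N t).map f.op).hom (w t)))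
    have hsum : ∑ t, x t = Finsupp.single f 1 := (hN k hk).1 <| by
      rw [map_sum, Finset.sum_congr rfl fun t _ => hx t, Finset.univ_sum_single]
      exact funext fun t => (FI.yonedaMap_single (N t) (w t) f).symm
    have hterm : ∀ t, θ t (toTensorPi M N w ((M.map f).hom m) t) = FI.act M _ _ (x t) m :=
      fun t => by
        rw [← hθ t k hk m _ (x t) (congrFun (hx t)), ← TensorFI.mk_map]
        rfl
    simp only [LinearMap.sum_apply, LinearMap.comp_apply, LinearMap.proj_apply, hterm]
    rw [← LinearMap.sum_apply, ← map_sum, hsum, FI.act_single, LinearMap.id_apply]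
  refine ⟨Function.LeftInverse.injective (g := fun z => ∑ t, θ t (z t)) fun m => ?_,
    fun z => ⟨∑ t, θ t (z t), ?_⟩⟩
  · simpa using LinearMap.congr_fun hleft m
  · rw [map_sum]
    exact (Finset.sum_congr rfl fun t _ => LinearMap.congr_fun (hright t) (z t)).trans
      (Finset.univ_sum_single z)

end Tensor

/-! The decomposition of `M_n` and the Hilbert polynomial -/

section Decomposition

variable {R : Type u} [CommRing R] {M : FI ⥤ ModuleCat.{v} R} {d : ℕ}

theorem nonempty_equiv_directSum (hM : IsPresentedInDegreesLE M d) {n : ℕ} (hn : 2 * d ≤ n + 1) :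
    Nonempty (M.obj (FI.std n) ≃ₗ[R] ⨁ ℓ : Fin (d + 1),
      (Fin (Nat.card (TwoRowFilling.SYT n ℓ)) → TailInvariant M ℓ)) := by
  let eTensor : M.obj (FI.std n) ≃ₗ[R] ∀ σ : Tableau n d, TailInvariant M σ.1 :=
    .ofBijective (toTensorPi M (fun σ : Tableau n d => Xi σ.1) Tableau.xi)
      (bijective_toTensorPi hM fun k hk => Tableau.bijective_yonedaMap_xi hn hk)
  let eCurry := LinearEquiv.piCurry R fun (ℓ : Fin (d + 1)) (_ : TwoRowFilling.SYT n ℓ) =>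
    TailInvariant M ℓ
  let eCount : (∀ ℓ : Fin (d + 1), TwoRowFilling.SYT n ℓ → TailInvariant M ℓ) ≃ₗ[R]
      ∀ ℓ : Fin (d + 1), Fin (Nat.card (TwoRowFilling.SYT n ℓ)) → TailInvariant M ℓ :=
    .piCongrRight fun ℓ => .funCongrLeft R _ (Finite.equivFin (TwoRowFilling.SYT n ℓ)).symm
  exact ⟨eTensor ≪≫ₗ eCurry ≪≫ₗ eCount ≪≫ₗ (DirectSum.linearEquivFunOnFintype R _ _).symm⟩

theorem finite_tailInvariant (hM : IsPresentedInDegreesLE M d)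
    (hfin : ∀ᶠ n : ℕ in atTop, Module.Finite R (M.obj (FI.std n))) (ℓ : Fin (d + 1)) :
    Module.Finite R (TailInvariant M ℓ) := by
  obtain ⟨n, hfinite, hn⟩ := (hfin.and (eventually_ge_atTop (2 * d))).exists
  obtain ⟨e⟩ := nonempty_equiv_directSum hM (n := n) (by omega)
  let i : Fin (Nat.card (TwoRowFilling.SYT n ℓ)) := ⟨0, TwoRowFilling.natCard_SYT_pos (by omega)⟩
  let e' := e ≪≫ₗ DirectSum.linearEquivFunOnFintype R _ _
  have hentry := LinearMap.proj_surjective (R := R) (φ := fun _ => TailInvariant M ℓ) i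
  have hsummand := LinearMap.proj_surjective (R := R) (φ := fun ℓ : Fin (d + 1) =>
    Fin (Nat.card (TwoRowFilling.SYT n ℓ)) → TailInvariant M ℓ) ℓ
  exact Module.Finite.of_surjective (LinearMap.proj i ∘ₗ LinearMap.proj ℓ ∘ₗ e'.toLinearMap)
    (hentry.comp (hsummand.comp e'.surjective))

theorem module_free_of_isField (hR : IsField R) (V : Type*) [AddCommGroup V] [Module R V] :
    Module.Free R V := by
  let := hR.toField
  exact Module.Free.of_divisionRing R V

theorem finrank_eq_sum_binomDiff_mul (hR : IsField R) (hM : IsPresentedInDegreesLE M d)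
    (hfin : ∀ᶠ n : ℕ in atTop, Module.Finite R (M.obj (FI.std n))) {n : ℕ} (hn : 2 * d ≤ n + 1) :
    (Module.finrank R (M.obj (FI.std n)) : ℤ) =
      ∑ ℓ : Fin (d + 1), binomDiff n ℓ * Module.finrank R (TailInvariant M ℓ) := by
  have := hR.nontrivial
  have (ℓ : Fin (d + 1)) : Module.Free R (TailInvariant M ℓ) := module_free_of_isField hR _
  have := finite_tailInvariant hM hfin
  obtain ⟨e⟩ := nonempty_equiv_directSum hM hn
  rw [e.finrank_eq, Module.finrank_directSum, Nat.cast_sum]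
  refine Finset.sum_congr rfl fun ℓ _ => ?_
  rw [Module.finrank_pi_fintype, Finset.sum_const, Finset.card_univ, Fintype.card_fin,
    smul_eq_mul, Nat.cast_mul, TwoRowFilling.natCard_SYT n ℓ (by omega)]

theorem eval_binomPoly (n ℓ : ℕ) : (binomPoly ℓ).eval (n : ℚ) = n.choose ℓ := by
  rw [binomPoly, Polynomial.eval_mul, Polynomial.eval_C, descPochhammer_eval_eq_descFactorial,
    Nat.descFactorial_eq_factorial_mul_choose, Nat.cast_mul,
    inv_mul_cancel_left₀ (Nat.cast_ne_zero.2 (Nat.factorial_ne_zero ℓ))]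

theorem eval_binomDiffPoly (n ℓ : ℕ) : (binomDiffPoly ℓ).eval (n : ℚ) = binomDiff n ℓ := by
  cases ℓ <;> simp [binomDiffPoly, binomDiff, eval_binomPoly]

theorem isHilbertPolynomial_sum (hR : IsField R) (hM : IsPresentedInDegreesLE M d)
    (hfin : ∀ᶠ n : ℕ in atTop, Module.Finite R (M.obj (FI.std n))) :
    IsHilbertPolynomial M
      (∑ ℓ : Fin (d + 1), Module.finrank R (TailInvariant M ℓ) • binomDiffPoly ℓ) := by
  filter_upwards [eventually_ge_atTop (2 * d)] with n hn
  rw [← Int.cast_natCast, finrank_eq_sum_binomDiff_mul hR hM hfin (by omega),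
    Polynomial.eval_finsetSum, Int.cast_sum]
  refine Finset.sum_congr rfl fun ℓ _ => ?_
  rw [Polynomial.eval_smul, eval_binomDiffPoly, nsmul_eq_mul, Int.cast_mul, Int.cast_natCast,
    mul_comm]

theorem IsHilbertPolynomial.eq {P Q : ℚ[X]} (hP : IsHilbertPolynomial M P)
    (hQ : IsHilbertPolynomial M Q) : P = Q := by
  refine Polynomial.eq_of_infinite_eval_eq P Q ?_
  have hfreq : ∃ᶠ n : ℕ in atTop, P.eval (n : ℚ) = Q.eval (n : ℚ) :=
    ((hP.and hQ).mono fun n hn => hn.1.symm.trans hn.2).frequently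
  refine ((Nat.frequently_atTop_iff_infinite.1 hfreq).image Nat.cast_injective.injOn).mono ?_
  rintro _ ⟨n, hn, rfl⟩
  exact hn

end Decomposition

end

theorem theoremA {R : Type u} [CommRing R] (M : FI ⥤ ModuleCat.{v} R) (d : ℕ)
    (hM : IsPresentedInDegreesLE M d) :
    (∀ n : ℕ, 2 * (d : ℤ) - 1 ≤ n →
      ∃ r : Fin (d + 1) → ℕ, (∀ ℓ, (r ℓ : ℤ) = binomDiff n ℓ) ∧
        Nonempty (M.obj (FI.std n) ≃ₗ[R]
          ⨁ ℓ : Fin (d + 1), (Fin (r ℓ) → TailInvariant M ℓ))) ∧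
    (IsField R → (∀ᶠ n : ℕ in atTop, Module.Finite R (M.obj (FI.std n))) →
      (∀ ℓ : Fin (d + 1), Module.Finite R (TailInvariant M ℓ)) ∧
      ∀ P : ℚ[X], IsHilbertPolynomial M P ↔
        P = ∑ ℓ : Fin (d + 1), Module.finrank R (TailInvariant M ℓ) • binomDiffPoly ℓ) := by
  refine ⟨fun n hn => ⟨fun ℓ => Nat.card (TwoRowFilling.SYT n ℓ),
    fun ℓ => TwoRowFilling.natCard_SYT n ℓ (by omega), nonempty_equiv_directSum hM (by omega)⟩,
    fun hR hfin => ⟨finite_tailInvariant hM hfin, fun P => ⟨fun hP => ?_, ?_⟩⟩⟩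
  · exact hP.eq (isHilbertPolynomial_sum hR hM hfin)
  · rintro rfl
    exact isHilbertPolynomial_sum hR hM hfin
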